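/- A game $A=(M_A,\lambda_A,b_A,P_A,W_A)$ consists of a set of moves $M_A$, an ownership map $\lambda_A:M_A\to\{O,P\}$, a starting protagonist $b_A\in\{O,P\}$, a nonempty prefix-closed set $P_A$ of finite plays (sequences that start with a $b_A$-move and alternate between $O$- and $P$-moves), and a set $W_A\subseteq\overline{P_A}$ of $P$-winning infinite plays, where $\overline{P_A}$ is the set of infinite sequences all of whose finite prefixes are in $P_A$. It is negative if $b_A=O$. Let $W_A^*$ be $W_A$ together with the finite plays that end in a $P$-move and, if $A$ is negative, the empty play. The negation is $A^\perp=(M_A,\neg\lambda_A,\neg b_A,P_A,\overline{P_A}\setminus W_A)$. For a negative game $N$, the plays of $A\oslash N$ are the alternating interleavings of a play of $A$ and a play of $N$ whose first move (if any) is in $A$ (so the starting protagonist is $b_A$), and an infinite play is $P$-winning iff its restrictions lie in $W_A^*$ and $W_N^*$. Put $M\multimap N=(N^\perp\oslash M)^\perp$. The negative game $!N$ has moves $M_N\times\mathbb N$ with $\lambda_{!N}(m,i)=\lambda_N(m)$; its plays are the alternating sequences starting with an $O$-move whose restriction to each copy $i$ is a play of $N$ and in which every move in copy $i+1$ is preceded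 by a move in copy $i$; an infinite play is $P$-winning iff its restriction to every copy lies in $W_N^*$. A strategy on $A$ is a set $\sigma\subseteq P_A$ of plays such that: if $sa\in\sigma$ then $a$ is a $P$-move; if $sab\in\sigma$ then $s\in\sigma$; if $sa,sb\in\sigma$ then $a=b$; if $\sigma=\varnothing$ then $b_A=P$; if $\epsilon\in\sigma$ then $b_A=O$. It is total if it is nonempty and whenever $s\in\sigma$ and $sa\in P_A$ there is $b$ with $sab\in\sigma$. A total strategy is winning if every $s\in\overline{P_A}$ all of whose prefixes ending in a $P$-move are in $\sigma$ is in $W_A$. Let $\mathcal G$ (resp. $\mathcal W$) be the category whose objects are negative games and whose arrows $A\to B$ are the strategies (resp. winning strategies) on $A\multimap B$. The composite of $\sigma:A\to B$ and $\tau:B\to C$ is $\tau\circ\sigma=\{s|_{A,C}: s\in(M_A+M_B+M_C)^*,\ s|_{A,B}\in\sigma,\ s|_{B,C}\in\tau\}$, and the identity on $A$ is the copycat strategy, i.e. the set of even-length plays of $A\multimap A$ all of whose even-length prefixes have equal restrictions to the two copies of $A$. For $\tau:C\to D$ let $\mathrm{id}\oslash\tau: N\oslash C\to N\oslash D$ be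 the set of plays of $(N\oslash C)\multimap(N\oslash D)$ whose restriction to the two copies of $N$ is in the identity and whose restriction to $C,D$ is in $\tau$. Let $\alpha:{!N}\to N\oslash{!N}$ be the copycat strategy relating, on the right, a move $a$ of $N$ to $(a,0)$ on the left, and a move $(a,n)$ of $!N$ to $(a,n+1)$ on the left; that is, the set of even-length plays all of whose even-length prefixes $t$ are such that relabelling $t|_{N\oslash !N}$ in this way gives $t|_{!N}$. **Proposition.** For every negative game $N$, $(!N,\alpha)$ is a final coalgebra of $N\oslash\_$ in the category $\mathcal W$: $\alpha$ is a winning strategy, and for every negative game $M$ and every winning strategy $\sigma:M\to N\oslash M$ there is a unique winning strategy $\tau:M\to{!N}$ such that $\alpha\circ\tau=(\mathrm{id}\oslash\tau)\circ\sigma$. In other words, anamorphisms of winning coalgebras are themselves total and winning: for every such $\sigma$, every strategy $\tau:M\to{!N}$ (an arrow of $\mathcal G$) with $\alpha\circ\tau=(\mathrm{id}\oslash\tau)\circ\sigma$ is total and winning. -/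

import Mathlib

universe u

namespace PlayGame

/-- The two protagonists: Opponent `O` and Player `P`. -/
inductive Player : Type
  | O
  | P

/-- Swapping the protagonists. -/
def Player.swap : Player → Player
  | .O => .P
  | .P => .O

/-- `s` starts with a move owned by `b` and alternates between `O`-moves and `P`-moves. -/
def Alternating {X : Type u} (lam : X → Player) : Player → List X → Prop
  | _, [] => True
  | b, a :: s => lam a = b ∧ Alternating lam b.swap s

/-- The prefix of length `n` of an infinite sequence. -/
def pre {X : Type u} (s : ℕ → X) (n : ℕ) : List X := (List.range n).map s

theorem Alternating.of_append {X : Type u} {lam : X → Player} :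
    ∀ {b : Player} {s t : List X}, Alternating lam b (s ++ t) → Alternating lam b s
  | _, [], _, _ => trivial
  | _, _ :: _, _, h => ⟨h.1, Alternating.of_append h.2⟩

theorem Alternating.of_prefix {X : Type u} {lam : X → Player} {b : Player} {s t : List X}
    (hst : s <+: t) (h : Alternating lam b t) : Alternating lam b s := by
  obtain ⟨r, rfl⟩ := hst
  exact h.of_append

theorem Alternating.swap {X : Type u} {lam : X → Player} :
    ∀ {b : Player} {s : List X}, Alternating lam b s →
      Alternating (fun m => (lam m).swap) b.swap s
  | _, [], _ => trivial
  | _, _ :: _, h => ⟨congrArg Player.swap h.1, Alternating.swap h.2⟩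

/-- A game: moves, their owners, the starting protagonist, the valid finite plays, and the
infinite plays won by Player. -/
structure Game : Type (u + 1) where
  Move : Type u
  lam : Move → Player
  start : Player
  plays : Set (List Move)
  alternating : ∀ s ∈ plays, Alternating lam start s
  nonempty : plays.Nonempty
  prefix_closed : ∀ s t, s <+: t → t ∈ plays → s ∈ plays
  win : Set (ℕ → Move)
  win_sub : ∀ s ∈ win, ∀ n, pre s n ∈ plays

namespace Game

/-- Negative games: Opponent starts. -/
def IsNegative (A : Game.{u}) : Prop := A.start = Player.O

/-- Infinite plays: all finite prefixes are valid plays. -/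
def infPlays (A : Game.{u}) : Set (ℕ → A.Move) := {s | ∀ n, pre s n ∈ A.plays}

/-- Finite plays won by Player: the last move was made by Player; the empty play is lost by
whoever has to start. -/
def finWin (A : Game.{u}) : Set (List A.Move) :=
  {s | s ∈ A.plays ∧
    ((∃ t a, s = t ++ [a] ∧ A.lam a = Player.P) ∨ (s = [] ∧ A.start = Player.O))}

/-- `A.RestrictionWins f s`: the restriction of the infinite sequence `s` along the partial
relabelling `f`, which may be an infinite or a finite sequence, is a play of `A` won by Player. -/
def RestrictionWins (A : Game.{u}) {X : Type u} (f : X → Option A.Move) (s : ℕ → X) : Prop :=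
  (∃ t ∈ A.win, ∀ n, ∃ k, (pre s k).filterMap f = pre t n) ∨
  (∃ v ∈ A.finWin, ∃ k, ∀ m, k ≤ m → (pre s m).filterMap f = v)

/-- Negation `A^⊥`. -/
def neg (A : Game.{u}) : Game.{u} where
  Move := A.Move
  lam := fun m => (A.lam m).swap
  start := A.start.swap
  plays := A.plays
  alternating := fun s hs => (A.alternating s hs).swap
  nonempty := A.nonempty
  prefix_closed := A.prefix_closed
  win := A.infPlays \ A.win
  win_sub := fun _ hs => hs.1

/-- Left merge (sequoid) `A ⊘ N`: interleavings of a play of `A` with a play of `N`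
in which no move of `N` occurs before the first move of `A`. -/
def sequoid (A N : Game.{u}) : Game.{u} where
  Move := A.Move ⊕ N.Move
  lam := Sum.elim A.lam N.lam
  start := A.start
  plays := {s | Alternating (Sum.elim A.lam N.lam) A.start s ∧
    s.filterMap Sum.getLeft? ∈ A.plays ∧ s.filterMap Sum.getRight? ∈ N.plays ∧
    ∀ t, t <+: s → t.filterMap Sum.getLeft? = [] → t.filterMap Sum.getRight? = []}
  alternating := fun _ hs => hs.1
  nonempty := by
    obtain ⟨a, ha⟩ := A.nonempty
    obtain ⟨n, hn⟩ := N.nonempty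
    refine ⟨[], trivial, A.prefix_closed _ _ (List.nil_prefix) ha,
      N.prefix_closed _ _ (List.nil_prefix) hn, ?_⟩
    intro t ht _
    rw [List.prefix_nil.1 ht]
    rfl
  prefix_closed := fun s t hst ht =>
    ⟨ht.1.of_prefix hst, A.prefix_closed _ _ (hst.filterMap _) ht.2.1,
      N.prefix_closed _ _ (hst.filterMap _) ht.2.2.1, fun r hr => ht.2.2.2 r (hr.trans hst)⟩
  win := {s | (∀ n, pre s n ∈ {s | Alternating (Sum.elim A.lam N.lam) A.start s ∧
      s.filterMap Sum.getLeft? ∈ A.plays ∧ s.filterMap Sum.getRight? ∈ N.plays ∧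
      ∀ t, t <+: s → t.filterMap Sum.getLeft? = [] → t.filterMap Sum.getRight? = []}) ∧
    A.RestrictionWins Sum.getLeft? s ∧ N.RestrictionWins Sum.getRight? s}
  win_sub := fun _ hs => hs.1

/-- `A ◁ Q = (A^⊥ ⊘ Q^⊥)^⊥`. -/
def lhd (A Q : Game.{u}) : Game.{u} := (A.neg.sequoid Q.neg).neg

/-- Affine implication `M ⊸ N = N ◁ M^⊥`; its moves are `N.Move ⊕ M.Move`. -/
def imp (M N : Game.{u}) : Game.{u} := N.lhd M.neg

/-- Selecting the moves of the copy number `i`. -/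
def copy {X : Type u} (i : ℕ) (m : X × ℕ) : Option X := if m.2 = i then some m.1 else none

/-- The exponential `!N`: interleavings of plays in copies of `N` tagged by `0, 1, 2, …`,
in which any move in copy `i + 1` is preceded by a move in copy `i`. -/
def bang (N : Game.{u}) : Game.{u} where
  Move := N.Move × ℕ
  lam := fun m => N.lam m.1
  start := Player.O
  plays := {s | Alternating (fun m : N.Move × ℕ => N.lam m.1) Player.O s ∧
    (∀ i, s.filterMap (copy i) ∈ N.plays) ∧
    ∀ t, t <+: s → ∀ i, t.filterMap (copy i) = [] → t.filterMap (copy (i + 1)) = []}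
  alternating := fun _ hs => hs.1
  nonempty := by
    obtain ⟨n, hn⟩ := N.nonempty
    refine ⟨[], trivial, fun i => N.prefix_closed _ _ (List.nil_prefix) hn, ?_⟩
    intro t ht i _
    rw [List.prefix_nil.1 ht]
    rfl
  prefix_closed := fun s t hst ht =>
    ⟨ht.1.of_prefix hst, fun i => N.prefix_closed _ _ (hst.filterMap _) (ht.2.1 i),
      fun r hr => ht.2.2 r (hr.trans hst)⟩
  win := {s | (∀ n, pre s n ∈ {s | Alternating (fun m : N.Move × ℕ => N.lam m.1) Player.O s ∧
      (∀ i, s.filterMap (copy i) ∈ N.plays) ∧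
      ∀ t, t <+: s → ∀ i, t.filterMap (copy i) = [] → t.filterMap (copy (i + 1)) = []}) ∧
    ∀ i, N.RestrictionWins (copy i) s}
  win_sub := fun _ hs => hs.1

/-- Strategies for Player, as sets of traces. -/
structure IsStrategy (A : Game.{u}) (σ : Set (List A.Move)) : Prop where
  sub : σ ⊆ A.plays
  ends_in_P : ∀ s a, s ++ [a] ∈ σ → A.lam a = Player.P
  closed : ∀ s a b, s ++ [a, b] ∈ σ → s ∈ σ
  deterministic : ∀ s a b, s ++ [a] ∈ σ → s ++ [b] ∈ σ → a = b
  of_empty : σ = ∅ → A.start = Player.P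
  of_nil_mem : [] ∈ σ → A.start = Player.O

/-- Total strategies. -/
structure IsTotal (A : Game.{u}) (σ : Set (List A.Move)) : Prop where
  isStrategy : A.IsStrategy σ
  nonempty : σ.Nonempty
  responds : ∀ s a, s ∈ σ → s ++ [a] ∈ A.plays → ∃ b, s ++ [a, b] ∈ σ

/-- Winning strategies: total, and every infinite play all of whose finite prefixes ending in a
`P`-move are in `σ` is won by Player. -/
structure IsWinning (A : Game.{u}) (σ : Set (List A.Move)) : Prop where
  isTotal : A.IsTotal σ
  wins : ∀ s ∈ A.infPlays,
    (∀ n, A.lam (s n) = Player.P → pre s (n + 1) ∈ σ) → s ∈ A.win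

/-- Sets of traces on `A ⊸ B`; an arrow `A → B` is such a set that is a strategy. -/
abbrev Traces (A B : Game.{u}) : Type u := Set (List (imp A B).Move)

/-- Forgetting the `C`-moves of an interaction of `A`, `B`, `C`. -/
def projAB {X Y Z : Type u} : X ⊕ Y ⊕ Z → Option (Y ⊕ X)
  | .inl a => some (.inr a)
  | .inr (.inl b) => some (.inl b)
  | .inr (.inr _) => none

/-- Forgetting the `A`-moves of an interaction of `A`, `B`, `C`. -/
def projBC {X Y Z : Type u} : X ⊕ Y ⊕ Z → Option (Z ⊕ Y)
  | .inl _ => none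
  | .inr (.inl b) => some (.inr b)
  | .inr (.inr c) => some (.inl c)

/-- Hiding the `B`-moves of an interaction of `A`, `B`, `C`. -/
def projAC {X Y Z : Type u} : X ⊕ Y ⊕ Z → Option (Z ⊕ X)
  | .inl a => some (.inr a)
  | .inr (.inl _) => none
  | .inr (.inr c) => some (.inl c)

/-- Composition `τ ∘ σ` of `σ : A → B` and `τ : B → C`: parallel composition plus hiding. -/
def comp {A B C : Game.{u}} (τ : Traces B C) (σ : Traces A B) : Traces A C :=
  {v | ∃ s : List (A.Move ⊕ B.Move ⊕ C.Move),
    s.filterMap projAB ∈ σ ∧ s.filterMap projBC ∈ τ ∧ s.filterMap projAC = v}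

/-- The copycat traces on `A ⊸ B` that relabel the moves of `B` to moves of `A` along `f`. -/
def copycat {A B : Game.{u}} (f : B.Move → A.Move) : Traces A B :=
  {s | s ∈ (imp A B).plays ∧ Even s.length ∧
    ∀ t, t <+: s → Even t.length →
      (t.filterMap Sum.getLeft?).map f = t.filterMap Sum.getRight?}

/-- The identity arrow `A → A`. -/
def identity (A : Game.{u}) : Traces A A := copycat id

/-- The moves in `A`, `B` of a sequence of moves of `(A ⊘ C) ⊸ (B ⊘ D)`. -/
def projFst {X Y Z T : Type u} : (Y ⊕ T) ⊕ (X ⊕ Z) → Option (Y ⊕ X)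
  | .inl (.inl b) => some (.inl b)
  | .inl (.inr _) => none
  | .inr (.inl a) => some (.inr a)
  | .inr (.inr _) => none

/-- The moves in `C`, `D` of a sequence of moves of `(A ⊘ C) ⊸ (B ⊘ D)`. -/
def projSnd {X Y Z T : Type u} : (Y ⊕ T) ⊕ (X ⊕ Z) → Option (T ⊕ Z)
  | .inl (.inl _) => none
  | .inl (.inr d) => some (.inl d)
  | .inr (.inl _) => none
  | .inr (.inr c) => some (.inr c)

/-- `σ ⊘ τ : A ⊘ C → B ⊘ D` plays as `σ : A → B` between `A` and `B` and as `τ : C → D` between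
`C` and `D`. -/
def sequoidMap {A B C D : Game.{u}} (σ : Traces A B) (τ : Traces C D) :
    Traces (A.sequoid C) (B.sequoid D) :=
  {s | s ∈ (imp (A.sequoid C) (B.sequoid D)).plays ∧
    s.filterMap projFst ∈ σ ∧ s.filterMap projSnd ∈ τ}

/-- The action of the functor `N ⊘ _` on an arrow `τ : C → D`: the arrow `id ⊘ τ`. -/
def sequoidFunctorMap (N : Game.{u}) {C D : Game.{u}} (τ : Traces C D) :
    Traces (N.sequoid C) (N.sequoid D) :=
  sequoidMap N.identity τ

/-- Relabelling the moves of `N ⊘ !N` to moves of `!N`. -/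
def shift {X : Type u} : X ⊕ (X × ℕ) → X × ℕ
  | .inl a => (a, 0)
  | .inr (a, n) => (a, n + 1)

/-- The copycat arrow `α : !N → N ⊘ !N`. -/
def alpha (N : Game.{u}) : Traces N.bang (N.sequoid N.bang) := copycat shift

/-- `τ` is a homomorphism from the coalgebra `(M, σ)` to the coalgebra `(Z, ζ)` of `N ⊘ _`:
`ζ ∘ τ = (id ⊘ τ) ∘ σ`. -/
def IsCoalgebraHom (N : Game.{u}) {M Z : Game.{u}} (σ : Traces M (N.sequoid M))
    (ζ : Traces Z (N.sequoid Z)) (τ : Traces M Z) : Prop :=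
  comp ζ τ = comp (N.sequoidFunctorMap τ) σ

/-- `(Z, ζ)` is a final coalgebra of `N ⊘ _` in the category of negative games and winning
strategies. -/
structure IsFinalCoalgebra (N Z : Game.{u}) (ζ : Traces Z (N.sequoid Z)) : Prop where
  isNegative : Z.IsNegative
  isWinning : (imp Z (N.sequoid Z)).IsWinning ζ
  existsUnique : ∀ (M : Game.{u}), M.IsNegative → ∀ σ : Traces M (N.sequoid M),
    (imp M (N.sequoid M)).IsWinning σ →
    ∃! τ : Traces M Z, (imp M Z).IsWinning τ ∧ N.IsCoalgebraHom σ ζ τ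

end Game

end PlayGame

namespace PlayGame

/-! In an interaction of `σ : M → N ⊘ M` with `id ⊘ τ`, the copycat on `N` can be elided. What
remains is a dialogue in which `σ` plays on the outer copy of `M`, on copy `0` of `!N` and on a
hidden copy of `M`, while `τ` plays on that hidden copy and on the other copies of `!N`. Composition
with `α` is mere relabelling along `shift`. So a homomorphism into `(!N, α)` is a fixed point of the
operator `unroll` (`isCoalgebraHom_iff`).

Fixed points exist and are unique among all strategies. The operator preserves strategies,
inclusions and unions, so its iterates from `{[]}` converge to a fixed point (`exists_unroll_eq`). A
play of a fixed point is built from a play of `τ` that lacks the moves of copy `0`, so two fixed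
points agree by induction on the number of moves in `!N` (`unroll_eq_unique`).

A fixed point wins its infinite plays: if Player wins the outer `M`, then, `σ` being winning, Player
wins copy `0` and the hidden `M`; the latter is the outer `M` of the play of `τ`, so the argument
repeats and reaches every copy (`limIn_copy`).

Totality could fail only if `σ` and `τ` talked on the hidden `M` for ever without answering
Opponent. The visible parts of such a dialogue are finite, so winning them means even length. The
argument just given shows that all of them are won, yet Opponent's unanswered move makes one of them
odd (`not_chatter`, `unroll_total`).

Throughout, plays are described by parities of the lengths of their restrictions, and infinite plays
by increasing chains of finite ones, whose restrictions may have finite or infinite limits. -/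

theorem Player.swap_ne_iff {a b : Player} : a = b.swap ↔ ¬ a = b := by
  cases a <;> cases b <;> simp [Player.swap]

theorem Player.swap_inj {a b : Player} : a.swap = b.swap ↔ a = b := by
  cases a <;> cases b <;> simp [Player.swap]

@[simp] theorem Player.swap_swap (a : Player) : a.swap.swap = a := by
  cases a <;> rfl

theorem Player.eq_P_iff {a : Player} : a = .P ↔ ¬ a = .O := by
  cases a <;> simp

/-- Alternation is turned into arithmetic: the owner of the next move depends only on a length, so
`omega` can decide whose turn it is. -/
theorem alternating_concat {X : Type u} {lam : X → Player} {s : List X} {a : X} :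
    ∀ {b : Player}, Alternating lam b (s ++ [a]) ↔
      Alternating lam b s ∧ (lam a = b ↔ s.length % 2 = 0) := by
  induction s with
  | nil => intro b; simp [Alternating]
  | cons c s ih =>
    intro b
    simp only [List.cons_append, Alternating, ih, List.length_cons, Player.swap_ne_iff, and_assoc]
    have : (¬ lam a = b ↔ s.length % 2 = 0) ↔ (lam a = b ↔ (s.length + 1) % 2 = 0) := by
      have h : (s.length + 1) % 2 = 0 ↔ ¬ s.length % 2 = 0 := by omega
      rw [h]; tauto
    rw [this]

theorem length_filterMap_getLeft?_add {X Y : Type*} (s : List (X ⊕ Y)) :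
    (s.filterMap Sum.getLeft?).length + (s.filterMap Sum.getRight?).length = s.length := by
  induction s with
  | nil => rfl
  | cons a s ih =>
    cases a
    · simp only [List.filterMap_cons, Sum.getLeft?_inl, Sum.getRight?_inl, List.length_cons]; omega
    · simp only [List.filterMap_cons, Sum.getLeft?_inr, Sum.getRight?_inr, List.length_cons]; omega

/-- Prefixes of a restriction are restrictions of prefixes. -/
theorem prefix_filterMap_iff {X Y : Type*} {f : X → Option Y} {s : List X} {w : List Y} :
    w <+: s.filterMap f ↔ ∃ t, t <+: s ∧ t.filterMap f = w := by
  constructor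
  · rintro ⟨r, hr⟩
    obtain ⟨l₁, l₂, h, h₁, -⟩ := List.filterMap_eq_append_iff.1 hr.symm
    exact ⟨l₁, ⟨l₂, h.symm⟩, h₁⟩
  · rintro ⟨t, ht, rfl⟩
    exact ht.filterMap _

/-! ### Plays as parity conditions on prefixes -/

/-- The condition on each prefix of a play of an affine implication. -/
structure ImpOk {X Y : Type*} (P : Set (List X)) (Q : Set (List Y)) (t : List (Y ⊕ X)) : Prop where
  left : t.filterMap Sum.getLeft? ∈ Q
  right : t.filterMap Sum.getRight? ∈ P
  parity : (t.filterMap Sum.getRight?).length % 2 ≤ (t.filterMap Sum.getLeft?).length % 2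

/-- The plays of an affine implication between negative games with plays `P` and `Q`. -/
def ImpPlays {X Y : Type*} (P : Set (List X)) (Q : Set (List Y)) : Set (List (Y ⊕ X)) :=
  {s | ∀ t, t <+: s → ImpOk P Q t}

/-- The condition on each prefix of a play of a sequoid. -/
structure SeqOk {X Y : Type*} (P : Set (List X)) (Q : Set (List Y)) (t : List (X ⊕ Y)) : Prop where
  left : t.filterMap Sum.getLeft? ∈ P
  right : t.filterMap Sum.getRight? ∈ Q
  parity : (t.filterMap Sum.getLeft?).length % 2 = 0 ∨ (t.filterMap Sum.getRight?).length % 2 = 0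
  init : t.filterMap Sum.getLeft? = [] → t.filterMap Sum.getRight? = []

/-- The plays of the sequoid of negative games with plays `P` and `Q`. -/
def SeqPlays {X Y : Type*} (P : Set (List X)) (Q : Set (List Y)) : Set (List (X ⊕ Y)) :=
  {s | ∀ t, t <+: s → SeqOk P Q t}

section

variable {X Y L : Type*} {P : Set (List X)} {Q : Set (List Y)}

/-- Moves the check to prefixes of the unrestricted sequence, where the other components stay in
view. -/
theorem filterMap_mem_impPlays {p : L → Option (Y ⊕ X)} {s : List L} :
    s.filterMap p ∈ ImpPlays P Q ↔ ∀ t, t <+: s → ImpOk P Q (t.filterMap p) := by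
  constructor
  · exact fun h t ht => h _ (ht.filterMap _)
  · rintro h w hw
    obtain ⟨t, ht, rfl⟩ := prefix_filterMap_iff.1 hw
    exact h t ht

theorem filterMap_mem_seqPlays {p : L → Option (X ⊕ Y)} {s : List L} :
    s.filterMap p ∈ SeqPlays P Q ↔ ∀ t, t <+: s → SeqOk P Q (t.filterMap p) := by
  constructor
  · exact fun h t ht => h _ (ht.filterMap _)
  · rintro h w hw
    obtain ⟨t, ht, rfl⟩ := prefix_filterMap_iff.1 hw
    exact h t ht

theorem concat_mem_impPlays {s : List (Y ⊕ X)} {x : Y ⊕ X} :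
    s ++ [x] ∈ ImpPlays P Q ↔ s ∈ ImpPlays P Q ∧ ImpOk P Q (s ++ [x]) := by
  simp only [ImpPlays, Set.mem_ofPred_eq, List.prefix_concat_iff]
  constructor
  · exact fun h => ⟨fun t ht => h t (.inr ht), h _ (.inl rfl)⟩
  · rintro ⟨h, h'⟩ t (rfl | ht)
    exacts [h', h t ht]

theorem impOk_of_mem {s : List (Y ⊕ X)} (h : s ∈ ImpPlays P Q) : ImpOk P Q s :=
  h s List.prefix_rfl

theorem seqOk_of_mem {s : List (X ⊕ Y)} (h : s ∈ SeqPlays P Q) : SeqOk P Q s :=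
  h s List.prefix_rfl

theorem impPlays_of_prefix {s t : List (Y ⊕ X)} (hst : s <+: t) (h : t ∈ ImpPlays P Q) :
    s ∈ ImpPlays P Q :=
  fun r hr => h r (hr.trans hst)

theorem seqPlays_of_prefix {s t : List (X ⊕ Y)} (hst : s <+: t) (h : t ∈ SeqPlays P Q) :
    s ∈ SeqPlays P Q :=
  fun r hr => h r (hr.trans hst)

end

/-! ### The parity description is correct for `⊸`, `⊘` and `!` -/

namespace Game

variable {A B M N : Game.{u}}

theorem nil_mem_plays (A : Game.{u}) : [] ∈ A.plays :=
  A.nonempty.elim fun _ h => A.prefix_closed _ _ List.nil_prefix h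

theorem lam_eq_O_iff (hA : A.IsNegative) {s : List A.Move} {a : A.Move}
    (h : s ++ [a] ∈ A.plays) : A.lam a = .O ↔ s.length % 2 = 0 := by
  have := A.alternating _ h
  rw [hA] at this
  exact (alternating_concat.1 this).2

theorem sequoid_isNegative (hA : A.IsNegative) : (A.sequoid B).IsNegative := hA

theorem bang_isNegative : N.bang.IsNegative := rfl

theorem imp_isNegative (hN : N.IsNegative) : (imp M N).IsNegative := by
  show N.start.swap.swap = _
  rw [Player.swap_swap]; exact hN

theorem imp_plays_start (hN : N.IsNegative) {s : List (N.Move ⊕ M.Move)} :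
    s ∈ (imp M N).plays ↔ Alternating (Sum.elim N.lam fun m => (M.lam m).swap) .O s ∧
    s.filterMap Sum.getLeft? ∈ N.plays ∧ s.filterMap Sum.getRight? ∈ M.plays ∧
    ∀ t, t <+: s → t.filterMap Sum.getLeft? = [] → t.filterMap Sum.getRight? = [] := by
  have hl : (fun x => (Sum.elim N.lam (fun m => (M.lam m).swap) x).swap) =
      Sum.elim N.neg.lam M.neg.neg.lam := by
    funext x; cases x <;> rfl
  have e : N.neg.start = Player.O.swap := congrArg Player.swap hN
  have key : Alternating (Sum.elim N.neg.lam M.neg.neg.lam) N.neg.start s ↔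
      Alternating (Sum.elim N.lam fun m => (M.lam m).swap) .O s := by
    rw [e, ← hl]
    refine ⟨fun h => ?_, fun h => h.swap⟩
    have h := h.swap
    simp only [Player.swap_swap] at h
    exact h
  exact and_congr_left' key

/-- The owner of a move can be read off its own component and off the whole play. When both
components are even, or both odd, Opponent is to move, and the component that would lead to an odd
`M`-part over an even `N`-part offers only moves of Player. -/
theorem imp_parity (hM : M.IsNegative) (hN : N.IsNegative) {s : List (N.Move ⊕ M.Move)}
    (hs : s ∈ (imp M N).plays) :
    (s.filterMap Sum.getRight?).length % 2 ≤ (s.filterMap Sum.getLeft?).length % 2 := by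
  induction s using List.reverseRecOn with
  | nil => simp
  | append_singleton s x ih =>
    have ih := ih ((imp M N).prefix_closed _ _ (List.prefix_append _ _) hs)
    obtain ⟨h1, h2, h3, -⟩ := (imp_plays_start hN).1 hs
    have h1 := (alternating_concat.1 h1).2
    have hl := length_filterMap_getLeft?_add s
    rcases x with n | m
    · rw [Sum.elim_inl] at h1
      simp only [List.filterMap_append, List.filterMap_cons, List.filterMap_nil,
        Sum.getLeft?_inl, Sum.getRight?_inl, List.length_append, List.append_nil,
        List.length_singleton] at h2 ⊢
      have := lam_eq_O_iff hN h2
      rw [this] at h1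
      omega
    · rw [Sum.elim_inr, show Player.O = Player.P.swap from rfl,
        Player.swap_inj, Player.eq_P_iff] at h1
      simp only [List.filterMap_append, List.filterMap_cons, List.filterMap_nil,
        Sum.getLeft?_inr, Sum.getRight?_inr, List.length_append, List.append_nil,
        List.length_singleton] at h3 ⊢
      have := lam_eq_O_iff hM h3
      rw [this] at h1
      omega

theorem mem_imp_plays (hM : M.IsNegative) (hN : N.IsNegative) {s : List (N.Move ⊕ M.Move)} :
    s ∈ (imp M N).plays ↔ s ∈ ImpPlays M.plays N.plays := by
  constructor
  · intro h t ht
    have h := (imp M N).prefix_closed _ _ ht h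
    have h' := (imp_plays_start hN).1 h
    exact ⟨h'.2.1, h'.2.2.1, imp_parity hM hN h⟩
  · intro h
    rw [imp_plays_start hN]
    have hs := h s List.prefix_rfl
    refine ⟨?_, hs.left, hs.right, ?_⟩
    · clear hs
      induction s using List.reverseRecOn with
      | nil => trivial
      | append_singleton s x ih =>
        refine alternating_concat.2 ⟨ih fun t ht => h t (ht.trans (List.prefix_append _ _)), ?_⟩
        have hl := length_filterMap_getLeft?_add s
        have h0 := (h s (List.prefix_append _ _)).parity
        obtain ⟨h2, h3, h1⟩ := h _ List.prefix_rfl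
        rcases x with n | m
        · rw [Sum.elim_inl]
          simp only [List.filterMap_append, List.filterMap_cons, List.filterMap_nil,
            Sum.getLeft?_inl, Sum.getRight?_inl, List.length_append, List.append_nil,
            List.length_singleton] at h2 h1
          rw [lam_eq_O_iff hN h2]
          omega
        · rw [Sum.elim_inr, show Player.O = Player.P.swap from rfl,
            Player.swap_inj, Player.eq_P_iff]
          simp only [List.filterMap_append, List.filterMap_cons, List.filterMap_nil,
            Sum.getLeft?_inr, Sum.getRight?_inr, List.length_append, List.append_nil,
            List.length_singleton] at h3 h1
          rw [lam_eq_O_iff hM h3]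
          omega
    · intro t ht
      replace h : ∀ r, r <+: t → ImpOk M.plays N.plays r := fun r hr => h r (hr.trans ht)
      clear ht hs
      induction t using List.reverseRecOn with
      | nil => simp
      | append_singleton t x ih =>
        have ih := ih fun r hr => h r (hr.trans (List.prefix_append _ _))
        have hp := (h _ List.prefix_rfl).parity
        intro h0
        -- A first move in `M` would be an odd right part next to an empty left part.
        rcases x with n | m
        · simp at h0
        · simp only [List.filterMap_append, List.filterMap_cons, List.filterMap_nil,
            Sum.getLeft?_inr, Sum.getRight?_inr, List.append_nil] at h0 hp
          rw [h0, ih h0] at hp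
          simp at hp

/-- While one component is odd Player is to move, and the even component offers only moves of
Opponent. -/
theorem sequoid_parity (hA : A.IsNegative) (hN : N.IsNegative) {s : List (A.Move ⊕ N.Move)}
    (hs : s ∈ (A.sequoid N).plays) :
    (s.filterMap Sum.getLeft?).length % 2 = 0 ∨ (s.filterMap Sum.getRight?).length % 2 = 0 := by
  induction s using List.reverseRecOn with
  | nil => simp
  | append_singleton s x ih =>
    have ih := ih ((A.sequoid N).prefix_closed _ _ (List.prefix_append _ _) hs)
    obtain ⟨h1, h2, h3, -⟩ := hs
    rw [hA] at h1
    have h1 := (alternating_concat.1 h1).2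
    have hl := length_filterMap_getLeft?_add s
    rcases x with n | m
    · simp only [List.filterMap_append, List.filterMap_cons, List.filterMap_nil,
        Sum.getLeft?_inl, Sum.getRight?_inl, List.length_append, List.append_nil,
        List.length_singleton] at h2 ⊢
      rw [Sum.elim_inl, lam_eq_O_iff hA h2] at h1
      omega
    · simp only [List.filterMap_append, List.filterMap_cons, List.filterMap_nil,
        Sum.getLeft?_inr, Sum.getRight?_inr, List.length_append, List.append_nil,
        List.length_singleton] at h3 ⊢
      rw [Sum.elim_inr, lam_eq_O_iff hN h3] at h1
      omega

theorem mem_sequoid_plays (hA : A.IsNegative) (hN : N.IsNegative) {s : List (A.Move ⊕ N.Move)} :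
    s ∈ (A.sequoid N).plays ↔ s ∈ SeqPlays A.plays N.plays := by
  constructor
  · intro h t ht
    have h := (A.sequoid N).prefix_closed _ _ ht h
    exact ⟨h.2.1, h.2.2.1, sequoid_parity hA hN h, h.2.2.2 t List.prefix_rfl⟩
  · intro h
    have hs := h s List.prefix_rfl
    refine ⟨?_, hs.left, hs.right, fun t ht => (h t ht).init⟩
    clear hs
    rw [hA]
    induction s using List.reverseRecOn with
    | nil => trivial
    | append_singleton s x ih =>
      refine alternating_concat.2 ⟨ih fun t ht => h t (ht.trans (List.prefix_append _ _)), ?_⟩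
      have hl := length_filterMap_getLeft?_add s
      have h0 := (h s (List.prefix_append _ _)).parity
      obtain ⟨h2, h3, h1, -⟩ := h _ List.prefix_rfl
      rcases x with n | m
      · simp only [List.filterMap_append, List.filterMap_cons, List.filterMap_nil,
          Sum.getLeft?_inl, Sum.getRight?_inl, List.length_append, List.append_nil,
          List.length_singleton] at h2 h1
        rw [Sum.elim_inl, lam_eq_O_iff hA h2]
        omega
      · simp only [List.filterMap_append, List.filterMap_cons, List.filterMap_nil,
          Sum.getLeft?_inr, Sum.getRight?_inr, List.length_append, List.append_nil,
          List.length_singleton] at h3 h1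
        rw [Sum.elim_inr, lam_eq_O_iff hN h3]
        omega

/-- In a play of `!N`, at most one copy has odd length, and then so has the whole play. -/
theorem bang_parity (hN : N.IsNegative) {s : List (N.Move × ℕ)}
    (h : Alternating (fun m : N.Move × ℕ => N.lam m.1) .O s)
    (h' : ∀ i, s.filterMap (copy i) ∈ N.plays) :
    (s.length % 2 = 0 → ∀ i, (s.filterMap (copy i)).length % 2 = 0) ∧
    ∀ i, (s.filterMap (copy i)).length % 2 = 1 →
      ∀ j, j ≠ i → (s.filterMap (copy j)).length % 2 = 0 := by
  induction s using List.reverseRecOn with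
  | nil => simp
  | append_singleton s x ih =>
    obtain ⟨y, k⟩ := x
    obtain ⟨h1, h2⟩ := alternating_concat.1 h
    obtain ⟨ih1, ih2⟩ := ih h1 fun i =>
      N.prefix_closed _ _ ((List.prefix_append _ _).filterMap _) (h' i)
    have h3 := h' k
    simp only [List.filterMap_append, List.filterMap_cons, List.filterMap_nil, copy, if_true]
      at h3
    rw [lam_eq_O_iff hN h3] at h2
    have key : ∀ i, ((s ++ [(y, k)]).filterMap (copy i)).length =
        (s.filterMap (copy i)).length + if k = i then 1 else 0 := by
      intro i
      by_cases hk : k = i <;> simp [copy, hk]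
    simp only [key, List.length_append, List.length_singleton]
    -- The owner of the last move is read off copy `k` and off the whole play, so before that move
    -- these two have the same parity.
    change (s.filterMap (copy k)).length % 2 = 0 ↔ _ at h2
    constructor
    · intro hs i
      have hk : (s.filterMap (copy k)).length % 2 = 1 := by omega
      by_cases hi : k = i
      · subst hi; simp; omega
      · have := ih2 k hk i (Ne.symm hi)
        simp [hi, this]
    · intro i hi j hj
      by_cases hs : s.length % 2 = 0
      · have a := ih1 hs i
        have b := ih1 hs j
        split_ifs at hi ⊢ <;> omega
      · have hk : (s.filterMap (copy k)).length % 2 = 1 := by omega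
        have a := ih2 k hk
        by_cases hki : k = i
        · subst hki; simp at hi; omega
        · have := a i (Ne.symm hki)
          simp [hki] at hi; omega

theorem copy_zero_comp_shift {Y : Type*} (s : List (Y ⊕ Y × ℕ)) :
    (s.map shift).filterMap (copy 0) = s.filterMap Sum.getLeft? := by
  rw [List.filterMap_map]
  congr 1; funext x
  rcases x with y | ⟨y, n⟩ <;> simp [shift, copy]

theorem copy_succ_comp_shift {Y : Type*} (i : ℕ) (s : List (Y ⊕ Y × ℕ)) :
    (s.map shift).filterMap (copy (i + 1)) =
      (s.filterMap Sum.getRight?).filterMap (copy i) := by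
  rw [List.filterMap_map, List.filterMap_filterMap]
  congr 1; funext x
  rcases x with y | ⟨y, n⟩ <;> simp [shift, copy]

theorem shift_bijective {Y : Type*} : Function.Bijective (shift (X := Y)) := by
  constructor
  · rintro (y | ⟨y, n⟩) (y' | ⟨y', n'⟩) h <;> simp_all [shift]
  · rintro ⟨y, _ | n⟩
    · exact ⟨.inl y, rfl⟩
    · exact ⟨.inr (y, n), rfl⟩

theorem eq_nil_of_copies {Y : Type*} {s : List (Y × ℕ)}
    (h : ∀ i, s.filterMap (copy i) = []) : s = [] := by
  cases s with
  | nil => rfl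
  | cons x s =>
    have := h x.2
    simp [copy] at this

theorem map_prefix_iff {X Y : Type*} {f : X → Y} {s : List X} {w : List Y} :
    w <+: s.map f ↔ ∃ t, t <+: s ∧ t.map f = w := by
  rw [← List.filterMap_eq_map]
  exact prefix_filterMap_iff

theorem alternating_map {X Y : Type u} {lam : Y → Player} {f : X → Y} {s : List X} :
    ∀ {b : Player}, Alternating lam b (s.map f) ↔ Alternating (fun x => lam (f x)) b s := by
  induction s with
  | nil => simp [Alternating]
  | cons a s ih => intro b; simp [Alternating, ih]

/-- Relabelling along `shift` identifies the plays of `N ⊘ !N` with those of `!N`. -/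
theorem map_shift_mem_bang_plays (hN : N.IsNegative) {s : List (N.Move ⊕ N.Move × ℕ)} :
    s.map shift ∈ N.bang.plays ↔ s ∈ SeqPlays N.plays N.bang.plays := by
  have hlam : (fun x : N.Move ⊕ N.Move × ℕ => N.lam (shift x).1) =
      Sum.elim N.lam fun m => N.lam m.1 := by
    funext x
    rcases x with y | ⟨y, n⟩ <;> rfl
  refine Iff.trans ?_ (mem_sequoid_plays hN bang_isNegative)
  suffices h : s.map shift ∈ N.bang.plays ↔
      Alternating (Sum.elim N.lam fun m : N.Move × ℕ => N.lam m.1) N.start s ∧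
      s.filterMap Sum.getLeft? ∈ N.plays ∧
      (Alternating (fun m : N.Move × ℕ => N.lam m.1) Player.O (s.filterMap Sum.getRight?) ∧
        (∀ i, (s.filterMap Sum.getRight?).filterMap (copy i) ∈ N.plays) ∧
        ∀ t, t <+: s.filterMap Sum.getRight? → ∀ i, t.filterMap (copy i) = [] →
          t.filterMap (copy (i + 1)) = []) ∧
      ∀ t, t <+: s → t.filterMap Sum.getLeft? = [] → t.filterMap Sum.getRight? = [] from h
  constructor
  · rintro ⟨h1, h2, h3⟩
    change Alternating (fun m : N.Move × ℕ => N.lam m.1) .O (s.map shift) at h1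
    change ∀ i, (s.map shift).filterMap (copy i) ∈ N.plays at h2
    change ∀ t : List (N.Move × ℕ), t <+: s.map shift → ∀ i, t.filterMap (copy i) = [] →
      t.filterMap (copy (i + 1)) = [] at h3
    have h0 : s.filterMap Sum.getLeft? ∈ N.plays := copy_zero_comp_shift s ▸ h2 0
    have h4 : ∀ t, t <+: s → ∀ i,
        (t.filterMap Sum.getRight?).filterMap (copy i) ∈ N.plays := by
      intro t ht i
      have := h2 (i + 1)
      rw [copy_succ_comp_shift] at this
      exact N.prefix_closed _ _ ((ht.filterMap _).filterMap _) this
    have hord : ∀ t, t <+: s → ∀ i, (t.filterMap Sum.getRight?).filterMap (copy i) = [] →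
        (t.filterMap Sum.getRight?).filterMap (copy (i + 1)) = [] := by
      intro t ht i hi
      have := h3 _ (ht.map shift) (i + 1)
      simp only [copy_succ_comp_shift] at this
      exact this hi
    have h1' := h1
    rw [alternating_map, hlam] at h1'
    refine ⟨by rw [hN]; exact h1', h0, ⟨?_, h4 s List.prefix_rfl, ?_⟩, ?_⟩
    · clear h0 hord h3
      induction s using List.reverseRecOn with
      | nil => trivial
      | append_singleton s x ih =>
        have hpre : s <+: s ++ [x] := List.prefix_append _ _
        have ih := ih (by rw [List.map_append] at h1; exact h1.of_append)
          (fun i => N.prefix_closed _ _ ((hpre.map _).filterMap _) (h2 i))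
          (fun t ht => h4 t (ht.trans hpre)) h1'.of_append
        rcases x with y | ⟨y, i⟩
        · have e : (s ++ [Sum.inl y]).filterMap Sum.getRight? = s.filterMap Sum.getRight? := by simp
          rw [e]
          exact ih
        · have e : (s ++ [Sum.inr (y, i)]).filterMap Sum.getRight? =
              s.filterMap Sum.getRight? ++ [(y, i)] := by simp
          rw [e]
          refine alternating_concat.2 ⟨ih, ?_⟩
          have a := (alternating_concat.1 h1').2
          have b := h4 _ List.prefix_rfl i
          rw [e] at b
          simp only [List.filterMap_append, List.filterMap_cons, List.filterMap_nil, copy,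
            if_true] at b
          have c := lam_eq_O_iff hN b
          have hs : (s.map shift) <+: (s ++ [Sum.inr (y, i)]).map shift := hpre.map _
          obtain ⟨q1, q2⟩ := bang_parity hN (h1.of_prefix hs)
            (fun i => N.prefix_closed _ _ (hs.filterMap _) (h2 i))
          have q1' := fun h => q1 h 0
          have q3 := fun h => q2 0 h (i + 1) (by omega)
          rw [copy_succ_comp_shift, copy_zero_comp_shift] at q3
          rw [copy_zero_comp_shift, List.length_map] at q1'
          have hl := length_filterMap_getLeft?_add s
          change N.lam y = .O ↔ _ at a
          change N.lam y = .O ↔ ((s.filterMap Sum.getRight?).filterMap (copy i)).length % 2 = 0 at c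
          change N.lam y = .O ↔ _
          -- Copy `0` is even at this point, so removing it does not change the parity: an `O`-move
          -- comes at even total length, where every copy is even, and a `P`-move comes in an odd
          -- copy `i + 1`, which excludes an odd copy `0`.
          by_cases hy : N.lam y = .O
          · have := q1' (a.1 hy)
            have := a.1 hy
            simp only [hy, true_iff]
            omega
          · simp only [hy, false_iff] at a c ⊢
            intro hc
            have : (s.filterMap Sum.getLeft?).length % 2 = 1 := by omega
            exact c (q3 this)
    · intro t ht i
      obtain ⟨t, ht', rfl⟩ := prefix_filterMap_iff.1 ht
      exact hord t ht' i
    · intro t ht h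
      refine eq_nil_of_copies fun i => ?_
      have := h3 _ (ht.map shift) 0
      rw [copy_zero_comp_shift, copy_succ_comp_shift] at this
      -- Emptiness spreads from copy `0` to all copies through the ordering rule of `!N`.
      induction i with
      | zero => exact this h
      | succ i ih => exact hord t ht i ih
  · rintro ⟨h1, h2, h3, h4⟩
    rw [hN, ← hlam, ← alternating_map (lam := fun m : N.Move × ℕ => N.lam m.1)] at h1
    refine ⟨h1, ?_, ?_⟩
    · rintro (_ | i)
      · rwa [copy_zero_comp_shift]
      · rw [copy_succ_comp_shift]
        exact h3.2.1 i
    · intro w hw i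
      obtain ⟨t, ht, rfl⟩ := map_prefix_iff.1 hw
      rcases i with _ | i
      · rw [copy_zero_comp_shift, copy_succ_comp_shift]
        intro h
        rw [h4 t ht h]; rfl
      · rw [copy_succ_comp_shift, copy_succ_comp_shift]
        exact h3.2.2 _ (ht.filterMap _) i

end Game

open Game

/-! ### Strategies as sets of even-length plays -/

/-- Strategies on a game in which Opponent starts, in terms of its set of plays `P`. -/
structure Strat {A : Type*} (P σ : Set (List A)) : Prop where
  sub : σ ⊆ P
  even : ∀ s ∈ σ, s.length % 2 = 0
  nil : [] ∈ σ
  closed : ∀ s a b, s ++ [a, b] ∈ σ → s ∈ σ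
  det : ∀ s a b, s ++ [a] ∈ σ → s ++ [b] ∈ σ → a = b

theorem mem_of_prefix_of_closed {A : Type*} {σ : Set (List A)}
    (h : ∀ s a b, s ++ [a, b] ∈ σ → s ∈ σ) (s : List A) :
    ∀ (n : ℕ) (r : List A), r.length = 2 * n → s ++ r ∈ σ → s ∈ σ := by
  intro n
  induction n with
  | zero =>
    intro r hr hs
    rw [List.length_eq_zero_iff.1 (by omega : r.length = 0), List.append_nil] at hs
    exact hs
  | succ n ih =>
    intro r hr hs
    induction r using List.reverseRecOn with
    | nil => simp at hr
    | append_singleton r b _ =>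
      induction r using List.reverseRecOn with
      | nil => simp at hr; omega
      | append_singleton r a _ =>
        refine ih r (by simp at hr; omega) (h _ a b ?_)
        simpa using hs

theorem Strat.of_prefix {A : Type*} {P σ : Set (List A)} (h : Strat P σ) {s t : List A}
    (ht : t ∈ σ) (hst : s <+: t) (hs : s.length % 2 = 0) : s ∈ σ := by
  have := h.even t ht
  obtain ⟨r, rfl⟩ := hst
  refine mem_of_prefix_of_closed h.closed s (r.length / 2) r ?_ ht
  rw [List.length_append] at this
  omega

theorem Strat.image {A B : Type*} {P σ : Set (List A)} {Q : Set (List B)} {f : A → B}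
    (hf : Function.Injective f) (hP : ∀ s, s.map f ∈ Q ↔ s ∈ P) (h : Strat P σ) :
    Strat Q (List.map f '' σ) where
  sub := by
    rintro _ ⟨s, hs, rfl⟩
    exact (hP s).2 (h.sub hs)
  even := by
    rintro _ ⟨s, hs, rfl⟩
    rw [List.length_map]
    exact h.even s hs
  nil := ⟨[], h.nil, rfl⟩
  closed := by
    rintro s a b ⟨t, ht, e⟩
    obtain ⟨t₁, t₂, rfl, rfl, e⟩ := List.map_eq_append_iff.1 e
    refine ⟨t₁, h.of_prefix ht (List.prefix_append _ _) ?_, rfl⟩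
    have h1 := h.even _ ht
    have h2 := congrArg List.length e
    simp at h1 h2
    omega
  det := by
    rintro s a b ⟨t, ht, e⟩ ⟨t', ht', e'⟩
    obtain ⟨t₁, t₂, rfl, rfl, e₂⟩ := List.map_eq_append_iff.1 e
    obtain ⟨t₁', t₂', rfl, e₁, e₂'⟩ := List.map_eq_append_iff.1 e'
    obtain rfl := hf.list_map e₁
    obtain ⟨a, rfl, rfl⟩ := List.map_eq_singleton_iff.1 e₂
    obtain ⟨b, rfl, rfl⟩ := List.map_eq_singleton_iff.1 e₂'
    rw [h.det _ _ _ ht ht']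

theorem Strat.iUnion {A : Type*} {P : Set (List A)} {σ : ℕ → Set (List A)}
    (h : ∀ n, Strat P (σ n)) (hm : Monotone σ) : Strat P (⋃ n, σ n) where
  sub := Set.iUnion_subset fun n => (h n).sub
  even := by
    intro s hs
    obtain ⟨n, hs⟩ := Set.mem_iUnion.1 hs
    exact (h n).even s hs
  nil := Set.mem_iUnion.2 ⟨0, (h 0).nil⟩
  closed := by
    intro s a b hs
    obtain ⟨n, hs⟩ := Set.mem_iUnion.1 hs
    exact Set.mem_iUnion.2 ⟨n, (h n).closed s a b hs⟩
  det := by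
    intro s a b ha hb
    obtain ⟨n, ha⟩ := Set.mem_iUnion.1 ha
    obtain ⟨m, hb⟩ := Set.mem_iUnion.1 hb
    exact (h (max n m)).det s a b (hm (le_max_left _ _) ha) (hm (le_max_right _ _) hb)

/-! ### Interactions of `σ` and `τ` without the copycat on `N` -/

/-- The moves of an interaction of `σ : M → N ⊘ M` and `τ : M → !N`: the visible moves of `M`,
the hidden moves of `M`, the moves of copy `0` of `N`, and those of the other copies. -/
inductive Letter (X Y : Type*)
  | ext (x : X)
  | hid (x : X)
  | zero (y : Y)
  | succ (p : Y × ℕ)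

namespace Letter

variable {X Y : Type*}

def ext? : Letter X Y → Option X
  | ext x => some x
  | _ => none

def hid? : Letter X Y → Option X
  | hid x => some x
  | _ => none

def zero? : Letter X Y → Option Y
  | zero y => some y
  | _ => none

def succ? : Letter X Y → Option (Y × ℕ)
  | succ p => some p
  | _ => none

/-- The moves of `M ⊸ (N ⊘ M)`. -/
def head? : Letter X Y → Option ((Y ⊕ X) ⊕ X)
  | ext x => some (.inr x)
  | hid x => some (.inl (.inr x))
  | zero y => some (.inl (.inl y))
  | succ _ => none

/-- The moves of `M ⊸ !N` that continue in the hidden copy of `M`. -/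
def tail? : Letter X Y → Option ((Y × ℕ) ⊕ X)
  | ext _ => none
  | hid x => some (.inr x)
  | zero _ => none
  | succ p => some (.inl p)

/-- The visible moves, as moves of `M ⊸ (N ⊘ !N)`. -/
def out? : Letter X Y → Option ((Y ⊕ Y × ℕ) ⊕ X)
  | ext x => some (.inr x)
  | hid _ => none
  | zero y => some (.inl (.inl y))
  | succ p => some (.inl (.inr p))

end Letter

/-- Relabelling the moves of `M ⊸ (N ⊘ !N)` to moves of `M ⊸ !N`. -/
def shiftLeft {X Y : Type*} : (Y ⊕ Y × ℕ) ⊕ X → (Y × ℕ) ⊕ X := Sum.map shift id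

theorem shiftLeft_bijective {X Y : Type*} : Function.Bijective (shiftLeft (X := X) (Y := Y)) :=
  ⟨shift_bijective.1.sumMap Function.injective_id,
    shift_bijective.2.sumMap Function.surjective_id⟩

section

open Letter

variable {X Y : Type*} (s : List (Letter X Y))

theorem head_right : (s.filterMap head?).filterMap Sum.getRight? = s.filterMap ext? := by
  rw [List.filterMap_filterMap]; congr 1; funext x; cases x <;> rfl

theorem head_left_left :
    ((s.filterMap head?).filterMap Sum.getLeft?).filterMap Sum.getLeft? = s.filterMap zero? := by
  rw [List.filterMap_filterMap, List.filterMap_filterMap]; congr 1; funext x; cases x <;> rfl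

theorem head_left_right :
    ((s.filterMap head?).filterMap Sum.getLeft?).filterMap Sum.getRight? = s.filterMap hid? := by
  rw [List.filterMap_filterMap, List.filterMap_filterMap]; congr 1; funext x; cases x <;> rfl

theorem tail_left : (s.filterMap tail?).filterMap Sum.getLeft? = s.filterMap succ? := by
  rw [List.filterMap_filterMap]; congr 1; funext x; cases x <;> rfl

theorem tail_right : (s.filterMap tail?).filterMap Sum.getRight? = s.filterMap hid? := by
  rw [List.filterMap_filterMap]; congr 1; funext x; cases x <;> rfl

theorem out_right : (s.filterMap out?).filterMap Sum.getRight? = s.filterMap ext? := by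
  rw [List.filterMap_filterMap]; congr 1; funext x; cases x <;> rfl

theorem out_left_left :
    ((s.filterMap out?).filterMap Sum.getLeft?).filterMap Sum.getLeft? = s.filterMap zero? := by
  rw [List.filterMap_filterMap, List.filterMap_filterMap]; congr 1; funext x; cases x <;> rfl

theorem out_left_right :
    ((s.filterMap out?).filterMap Sum.getLeft?).filterMap Sum.getRight? = s.filterMap succ? := by
  rw [List.filterMap_filterMap, List.filterMap_filterMap]; congr 1; funext x; cases x <;> rfl

theorem length_head_left : ((s.filterMap head?).filterMap Sum.getLeft?).length =
    (s.filterMap zero?).length + (s.filterMap hid?).length := by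
  rw [← length_filterMap_getLeft?_add, head_left_left, head_left_right]

theorem length_head : (s.filterMap head?).length =
    (s.filterMap zero?).length + (s.filterMap hid?).length + (s.filterMap ext?).length := by
  rw [← length_filterMap_getLeft?_add, length_head_left, head_right]

theorem length_tail : (s.filterMap tail?).length =
    (s.filterMap succ?).length + (s.filterMap hid?).length := by
  rw [← length_filterMap_getLeft?_add, tail_left, tail_right]

theorem length_out_left : ((s.filterMap out?).filterMap Sum.getLeft?).length =
    (s.filterMap zero?).length + (s.filterMap succ?).length := by
  rw [← length_filterMap_getLeft?_add, out_left_left, out_left_right]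

theorem length_out : (s.filterMap out?).length =
    (s.filterMap zero?).length + (s.filterMap succ?).length + (s.filterMap ext?).length := by
  rw [← length_filterMap_getLeft?_add, length_out_left, out_right]

end

section

open Letter

variable {X Y : Type*} (PM : Set (List X)) (PN : Set (List Y)) (PB : Set (List (Y × ℕ)))

/-- The condition on each prefix of an interaction. -/
structure ConfOk (t : List (Letter X Y)) : Prop where
  ext : t.filterMap ext? ∈ PM
  hid : t.filterMap hid? ∈ PM
  zero : t.filterMap zero? ∈ PN
  succ : t.filterMap succ? ∈ PB
  ext_le_head : (t.filterMap ext?).length % 2 ≤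
    ((t.filterMap zero?).length + (t.filterMap hid?).length) % 2
  zero_hid : (t.filterMap zero?).length % 2 = 0 ∨ (t.filterMap hid?).length % 2 = 0
  hid_le : (t.filterMap hid?).length % 2 ≤ (t.filterMap succ?).length % 2
  ext_le_out : (t.filterMap ext?).length % 2 ≤
    ((t.filterMap zero?).length + (t.filterMap succ?).length) % 2
  zero_succ : (t.filterMap zero?).length % 2 = 0 ∨ (t.filterMap succ?).length % 2 = 0
  init : t.filterMap zero? = [] → t.filterMap hid? = [] ∧ t.filterMap succ? = []

/-- The interactions all of whose restrictions are plays. -/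
def Conf : Set (List (Letter X Y)) := {s | ∀ t, t <+: s → ConfOk PM PN PB t}

variable {PM PN PB}

/-- The three restrictions share four components, so all their conditions together are statements
about these four alone. -/
theorem mem_conf_iff {s : List (Letter X Y)} : s ∈ Conf PM PN PB ↔
    s.filterMap head? ∈ ImpPlays PM (SeqPlays PN PM) ∧ s.filterMap tail? ∈ ImpPlays PM PB ∧
      s.filterMap out? ∈ ImpPlays PM (SeqPlays PN PB) := by
  constructor
  · intro h
    simp only [filterMap_mem_impPlays]
    refine ⟨fun t ht => ?_, fun t ht => ?_, fun t ht => ?_⟩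
    · refine ⟨?_, ?_, ?_⟩
      · rw [List.filterMap_filterMap, filterMap_mem_seqPlays]
        intro r hr
        have hr := h r (hr.trans ht)
        rw [← List.filterMap_filterMap]
        refine ⟨?_, ?_, ?_, ?_⟩ <;> simp only [head_left_left, head_left_right]
        exacts [hr.zero, hr.hid, hr.zero_hid, fun e => (hr.init e).1]
      · rw [head_right]; exact (h t ht).ext
      · rw [head_right, length_head_left]; exact (h t ht).ext_le_head
    · refine ⟨?_, ?_, ?_⟩ <;> simp only [tail_left, tail_right]
      exacts [(h t ht).succ, (h t ht).hid, (h t ht).hid_le]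
    · refine ⟨?_, ?_, ?_⟩
      · rw [List.filterMap_filterMap, filterMap_mem_seqPlays]
        intro r hr
        have hr := h r (hr.trans ht)
        rw [← List.filterMap_filterMap]
        refine ⟨?_, ?_, ?_, ?_⟩ <;> simp only [out_left_left, out_left_right]
        exacts [hr.zero, hr.succ, hr.zero_succ, fun e => (hr.init e).2]
      · rw [out_right]; exact (h t ht).ext
      · rw [out_right, length_out_left]; exact (h t ht).ext_le_out
  · rintro ⟨h1, h2, h3⟩ t ht
    have h1 := impOk_of_mem (impPlays_of_prefix (ht.filterMap _) h1)
    have h2 := impOk_of_mem (impPlays_of_prefix (ht.filterMap _) h2)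
    have h3 := impOk_of_mem (impPlays_of_prefix (ht.filterMap _) h3)
    have h4 := seqOk_of_mem h1.left
    have h5 := seqOk_of_mem h3.left
    obtain ⟨a1, a2, a3, a4⟩ := h4
    obtain ⟨b1, b2, b3, b4⟩ := h5
    have c1 := h1.parity
    have c2 := h3.parity
    obtain ⟨d1, d2, d3⟩ := h2
    have d4 := h1.right
    rw [length_head_left, head_right] at c1
    rw [length_out_left, out_right] at c2
    simp only [head_left_left, head_left_right, out_left_left, out_left_right, tail_left,
      tail_right, head_right] at *
    exact ⟨d4, d2, a1, d1, c1, a3, d3, c2, b3, fun e => ⟨a4 e, b4 e⟩⟩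

theorem confOk_of_mem {s : List (Letter X Y)} (h : s ∈ Conf PM PN PB) : ConfOk PM PN PB s :=
  h s List.prefix_rfl

theorem conf_of_prefix {s t : List (Letter X Y)} (hst : s <+: t) (h : t ∈ Conf PM PN PB) :
    s ∈ Conf PM PN PB :=
  fun r hr => h r (hr.trans hst)

theorem concat_mem_conf {s : List (Letter X Y)} {x : Letter X Y} :
    s ++ [x] ∈ Conf PM PN PB ↔ s ∈ Conf PM PN PB ∧ ConfOk PM PN PB (s ++ [x]) := by
  simp only [Conf, Set.mem_ofPred_eq, List.prefix_concat_iff]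
  constructor
  · exact fun h => ⟨fun t ht => h t (.inr ht), h _ (.inl rfl)⟩
  · rintro ⟨h, h'⟩ t (rfl | ht)
    exacts [h', h t ht]

/-- The possible parities of the restrictions of an interaction. -/
theorem ConfOk.parities {t : List (Letter X Y)} (h : ConfOk PM PN PB t) :
    let e := (t.filterMap ext?).length % 2
    let d := (t.filterMap hid?).length % 2
    let z := (t.filterMap zero?).length % 2
    let c := (t.filterMap succ?).length % 2
    (z = 0 ∧ e = 0 ∧ d = 0 ∧ c = 0) ∨ (z = 0 ∧ e = 0 ∧ d = 0 ∧ c = 1) ∨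
    (z = 0 ∧ e = 0 ∧ d = 1 ∧ c = 1) ∨ (z = 0 ∧ e = 1 ∧ d = 1 ∧ c = 1) ∨
    (z = 1 ∧ e = 0 ∧ d = 0 ∧ c = 0) ∨ (z = 1 ∧ e = 1 ∧ d = 0 ∧ c = 0) := by
  -- Of sixteen parity vectors `(z, e, d, c)` six survive. Opponent is to move at `0000`, `0111` and
  -- `1100`, `σ` at `0011` and `1000`, and `τ` at `0001`.
  obtain ⟨-, -, -, -, h1, h2, h3, h4, h5, -⟩ := h
  simp only
  rw [Nat.add_mod] at h1 h4
  rcases Nat.mod_two_eq_zero_or_one (t.filterMap ext?).length with a1 | a1 <;>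
  rcases Nat.mod_two_eq_zero_or_one (t.filterMap hid?).length with a2 | a2 <;>
  rcases Nat.mod_two_eq_zero_or_one (t.filterMap zero?).length with a3 | a3 <;>
  rcases Nat.mod_two_eq_zero_or_one (t.filterMap succ?).length with a4 | a4 <;>
  simp_all

/-- Allows an interaction to be cut at an even visible length: neither `σ` nor `τ` owes a move
there, so both restrictions can lie in the strategies. -/
theorem conf_settled {s : List (Letter X Y)} (h : s ∈ Conf PM PN PB) :
    (s.filterMap out?).length % 2 = 0 ↔
      (s.filterMap head?).length % 2 = 0 ∧ (s.filterMap tail?).length % 2 = 0 := by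
  have h := (confOk_of_mem h).parities
  rw [length_out, length_head, length_tail]
  rcases h with h | h | h | h | h | h <;> omega

/-- A letter outside the game of the participant to move would lead to a parity vector not listed in
`ConfOk.parities`. -/
theorem conf_mover {s : List (Letter X Y)} {x : Letter X Y} (hx : s ++ [x] ∈ Conf PM PN PB) :
    ((s.filterMap head?).length % 2 = 1 → ∃ y, head? x = some y) ∧
    ((s.filterMap tail?).length % 2 = 1 → ∃ y, tail? x = some y) ∧
    ((s.filterMap out?).length % 2 = 0 → ∃ y, out? x = some y) := by
  obtain ⟨h, h'⟩ := concat_mem_conf.1 hx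
  have h := (confOk_of_mem h).parities
  have h' := h'.parities
  rw [length_out, length_head, length_tail]
  simp only [List.filterMap_append, List.length_append] at h'
  cases x <;> refine ⟨fun g => ?_, fun g => ?_, fun g => ?_⟩ <;>
  first
  | exact ⟨_, rfl⟩
  | exfalso
    simp only [List.filterMap_cons, List.filterMap_nil, ext?, hid?, zero?, succ?,
      List.length_nil, List.length_singleton, Nat.add_zero] at h'
    rcases h with h | h | h | h | h | h <;> rcases h' with h' | h' | h' | h' | h' | h' <;> omega

theorem head?_inj {x y : Letter X Y} {a} (hx : head? x = some a) (hy : head? y = some a) :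
    x = y := by
  cases x <;> cases y <;> simp_all [head?] <;> subst hy <;> simp_all

theorem tail?_inj {x y : Letter X Y} {a} (hx : tail? x = some a) (hy : tail? y = some a) :
    x = y := by
  cases x <;> cases y <;> simp_all [tail?] <;> subst hy <;> simp_all

theorem out?_inj {x y : Letter X Y} {a} (hx : out? x = some a) (hy : out? y = some a) :
    x = y := by
  cases x <;> cases y <;> simp_all [out?] <;> subst hy <;> simp_all

theorem filterMap_concat_some {A B : Type*} {f : A → Option B} {s : List A} {x : A} {b : B}
    (h : f x = some b) : (s ++ [x]).filterMap f = s.filterMap f ++ [b] := by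
  rw [List.filterMap_append, List.filterMap_cons_some h, List.filterMap_nil]

/-! ### Legal interactions are deterministic; their visible plays form a strategy -/

variable (PM PN PB) in
/-- The interactions that are consistent with the strategies `σ` and `τ`. -/
structure Legal (σ : Set (List ((Y ⊕ X) ⊕ X))) (τ : Set (List ((Y × ℕ) ⊕ X)))
    (s : List (Letter X Y)) : Prop where
  conf : s ∈ Conf PM PN PB
  head : ∀ t, t <+: s → (t.filterMap head?).length % 2 = 0 → t.filterMap head? ∈ σ
  tail : ∀ t, t <+: s → (t.filterMap tail?).length % 2 = 0 → t.filterMap tail? ∈ τ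

variable {σ : Set (List ((Y ⊕ X) ⊕ X))} {τ : Set (List ((Y × ℕ) ⊕ X))}

theorem Legal.of_prefix {s t : List (Letter X Y)} (h : Legal PM PN PB σ τ t) (hst : s <+: t) :
    Legal PM PN PB σ τ s :=
  ⟨conf_of_prefix hst h.conf, fun r hr => h.head r (hr.trans hst),
    fun r hr => h.tail r (hr.trans hst)⟩

theorem legal_of_mem (hσ : Strat (ImpPlays PM (SeqPlays PN PM)) σ)
    (hτ : Strat (ImpPlays PM PB) τ) {s : List (Letter X Y)} (h1 : s.filterMap head? ∈ σ)
    (h2 : s.filterMap tail? ∈ τ) (h3 : s.filterMap out? ∈ ImpPlays PM (SeqPlays PN PB)) :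
    Legal PM PN PB σ τ s :=
  ⟨mem_conf_iff.2 ⟨hσ.sub h1, hτ.sub h2, h3⟩, fun _ ht h => hσ.of_prefix h1 (ht.filterMap _) h,
    fun _ ht h => hτ.of_prefix h2 (ht.filterMap _) h⟩

/-- Two legal interactions diverge only by distinct visible moves of Opponent. -/
theorem Legal.prefix_or_prefix (hσ : Strat (ImpPlays PM (SeqPlays PN PM)) σ)
    (hτ : Strat (ImpPlays PM PB) τ) {s s' : List (Letter X Y)} (h : Legal PM PN PB σ τ s)
    (h' : Legal PM PN PB σ τ s')
    (hO : ∀ r x y, r.length % 2 = 0 → r ++ [x] <+: s.filterMap out? →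
      r ++ [y] <+: s'.filterMap out? → x = y) : s <+: s' ∨ s' <+: s := by
  induction s using List.reverseRecOn with
  | nil => exact .inl List.nil_prefix
  | append_singleton p x ih =>
    have hp : p <+: p ++ [x] := List.prefix_append _ _
    rcases ih (h.of_prefix hp) fun r a b hr ha => hO r a b hr (ha.trans (hp.filterMap _)) with
      ⟨r, rfl⟩ | h1
    · rcases r with _ | ⟨y, r⟩
      · right; simp
      · left
        have hy : p ++ [y] <+: p ++ y :: r := ⟨r, by simp⟩
        suffices x = y by rw [this]; exact hy
        have h'' := h'.of_prefix hy
        obtain ⟨a1, a2, a3⟩ := conf_mover h.conf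
        obtain ⟨b1, b2, b3⟩ := conf_mover h''.conf
        have key := conf_settled (h.of_prefix hp).conf
        -- Exactly one of `σ`, `τ` and Opponent is to move after `p`. Determinism of `σ` or of `τ`
        -- forces `x = y` in the former cases, `hO` in the last.
        by_cases c1 : (p.filterMap head?).length % 2 = 1
        · obtain ⟨a, ha⟩ := a1 c1
          obtain ⟨b, hb⟩ := b1 c1
          have e1 := h.head _ List.prefix_rfl
          have e2 := h''.head _ List.prefix_rfl
          rw [filterMap_concat_some ha, List.length_append, List.length_singleton] at e1
          rw [filterMap_concat_some hb, List.length_append, List.length_singleton] at e2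
          have := hσ.det _ _ _ (e1 (by omega)) (e2 (by omega))
          exact head?_inj ha (this ▸ hb)
        by_cases c2 : (p.filterMap tail?).length % 2 = 1
        · obtain ⟨a, ha⟩ := a2 c2
          obtain ⟨b, hb⟩ := b2 c2
          have e1 := h.tail _ List.prefix_rfl
          have e2 := h''.tail _ List.prefix_rfl
          rw [filterMap_concat_some ha, List.length_append, List.length_singleton] at e1
          rw [filterMap_concat_some hb, List.length_append, List.length_singleton] at e2
          have := hτ.det _ _ _ (e1 (by omega)) (e2 (by omega))
          exact tail?_inj ha (this ▸ hb)
        have c3 := key.2 ⟨by omega, by omega⟩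
        obtain ⟨a, ha⟩ := a3 c3
        obtain ⟨b, hb⟩ := b3 c3
        have := hO _ a b c3 (by rw [filterMap_concat_some ha])
          (by rw [← filterMap_concat_some hb]; exact hy.filterMap _)
        exact out?_inj ha (this ▸ hb)
    · exact .inr (h1.trans hp)

variable (PM PN PB σ τ) in
/-- The visible plays of the interactions of `σ` and `τ`, as plays of `M ⊸ (N ⊘ !N)`. -/
def visible : Set (List ((Y ⊕ Y × ℕ) ⊕ X)) :=
  {v | ∃ s : List (Letter X Y), s.filterMap head? ∈ σ ∧ s.filterMap tail? ∈ τ ∧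
    s.filterMap out? ∈ ImpPlays PM (SeqPlays PN PB) ∧ s.filterMap out? = v}

theorem visible_mono {τ' : Set (List ((Y × ℕ) ⊕ X))} (h : τ ⊆ τ') :
    visible PM PN PB σ τ ⊆ visible PM PN PB σ τ' := by
  rintro v ⟨s, h1, h2, h3⟩
  exact ⟨s, h1, h h2, h3⟩

/-- A visible play is witnessed by a single play of `τ`, so the family need not be increasing. -/
theorem visible_iUnion {τ : ℕ → Set (List ((Y × ℕ) ⊕ X))} :
    visible PM PN PB σ (⋃ n, τ n) = ⋃ n, visible PM PN PB σ (τ n) := by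
  ext v
  simp only [visible, Set.mem_ofPred_eq, Set.mem_iUnion]
  constructor
  · rintro ⟨s, h1, ⟨n, h2⟩, h3⟩
    exact ⟨n, s, h1, h2, h3⟩
  · rintro ⟨n, s, h1, h2, h3⟩
    exact ⟨s, h1, ⟨n, h2⟩, h3⟩

theorem visible_strat (hσ : Strat (ImpPlays PM (SeqPlays PN PM)) σ)
    (hτ : Strat (ImpPlays PM PB) τ) (hnil : [] ∈ ImpPlays PM (SeqPlays PN PB)) :
    Strat (ImpPlays PM (SeqPlays PN PB)) (visible PM PN PB σ τ) := by
  have even : ∀ s : List (Letter X Y), s.filterMap head? ∈ σ → s.filterMap tail? ∈ τ →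
      (s.filterMap out?).length % 2 = 0 := by
    intro s h1 h2
    have h1 := hσ.even _ h1
    have h2 := hτ.even _ h2
    rw [length_head] at h1
    rw [length_tail] at h2
    rw [length_out]
    omega
  refine ⟨?_, ?_, ⟨[], hσ.nil, hτ.nil, hnil, rfl⟩, ?_, ?_⟩
  · rintro v ⟨s, h1, h2, h3, rfl⟩
    exact h3
  · rintro v ⟨s, h1, h2, h3, rfl⟩
    exact even s h1 h2
  · rintro w a b ⟨s, h1, h2, h3, e⟩
    have hl := legal_of_mem hσ hτ h1 h2 h3
    have hev := even s h1 h2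
    obtain ⟨l₁, l₂, rfl, rfl, -⟩ := List.filterMap_eq_append_iff.1 e
    have hl₁ := hl.of_prefix (List.prefix_append _ _)
    -- The visible play loses two moves, so the cut `l₁` is settled.
    have hw : (l₁.filterMap out?).length % 2 = 0 := by
      rw [e] at hev
      simp at hev
      omega
    obtain ⟨c1, c2⟩ := (conf_settled hl₁.conf).1 hw
    exact ⟨l₁, hl₁.head _ List.prefix_rfl c1, hl₁.tail _ List.prefix_rfl c2,
      (mem_conf_iff.1 hl₁.conf).2.2, rfl⟩
  · rintro w a b ⟨s, h1, h2, h3, e⟩ ⟨s', h1', h2', h3', e'⟩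
    have hev := even s h1 h2
    rw [e, List.length_append, List.length_singleton] at hev
    have key : s <+: s' ∨ s' <+: s := by
      refine (legal_of_mem hσ hτ h1 h2 h3).prefix_or_prefix hσ hτ
        (legal_of_mem hσ hτ h1' h2' h3') ?_
      intro r x y hr hx hy
      -- The final moves `a` and `b` come after the odd-length play `w`, so a move that follows an
      -- even-length `r` lies inside `w`, where the two visible plays coincide.
      rw [e, List.prefix_concat_iff] at hx
      rw [e', List.prefix_concat_iff] at hy
      have hx : r ++ [x] <+: w := hx.resolve_left fun h => by
        have := congrArg List.length h
        simp at this; omega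
      have hy : r ++ [y] <+: w := hy.resolve_left fun h => by
        have := congrArg List.length h
        simp at this; omega
      have := List.prefix_of_prefix_length_le hx hy (by simp)
      simpa using this.eq_of_length (by simp)
    have : w ++ [a] = w ++ [b] := by
      rcases key with h | h
      · have := h.filterMap out?
        rw [e, e'] at this
        exact this.eq_of_length (by simp)
      · have := h.filterMap out?
        rw [e, e'] at this
        exact (this.eq_of_length (by simp)).symm
    simpa using this

/-! ### The operator `unroll` has exactly one fixed point -/

variable (PM PN PB σ τ) in
/-- The visible plays of the interactions of `σ` and `τ`, as plays of `M ⊸ !N`. -/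
def unroll : Set (List ((Y × ℕ) ⊕ X)) := List.map shiftLeft '' visible PM PN PB σ τ

variable (PM PN PB) in
/-- Relabelling along `shiftLeft` identifies the plays of `M ⊸ (N ⊘ !N)` and `M ⊸ !N`. -/
def ShiftPlays : Prop := ∀ s : List ((Y ⊕ Y × ℕ) ⊕ X),
  s.map shiftLeft ∈ ImpPlays PM PB ↔ s ∈ ImpPlays PM (SeqPlays PN PB)

theorem unroll_strat (hσ : Strat (ImpPlays PM (SeqPlays PN PM)) σ)
    (hτ : Strat (ImpPlays PM PB) τ) (hsh : ShiftPlays PM PN PB) :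
    Strat (ImpPlays PM PB) (unroll PM PN PB σ τ) :=
  (visible_strat hσ hτ ((hsh []).1 (hτ.sub hτ.nil))).image shiftLeft_bijective.1 hsh

/-- The anamorphism of `σ`. -/
theorem exists_unroll_eq (hσ : Strat (ImpPlays PM (SeqPlays PN PM)) σ)
    (hsh : ShiftPlays PM PN PB) (hnil : [] ∈ ImpPlays PM PB) :
    ∃ τ, Strat (ImpPlays PM PB) τ ∧ unroll PM PN PB σ τ = τ := by
  -- Kleene iteration from the least strategy.
  let T : ℕ → Set (List ((Y × ℕ) ⊕ X)) := fun n => (unroll PM PN PB σ)^[n] {[]}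
  have hT0 : T 0 = {[]} := rfl
  have hT : ∀ n, T (n + 1) = unroll PM PN PB σ (T n) := fun n =>
    Function.iterate_succ_apply' _ _ _
  have hs : ∀ n, Strat (ImpPlays PM PB) (T n) := by
    intro n
    induction n with
    | zero =>
      rw [hT0]
      exact ⟨by simpa using hnil, by simp, rfl, by simp, by simp⟩
    | succ n ih => rw [hT]; exact unroll_strat hσ ih hsh
  have hm : Monotone T := by
    refine monotone_nat_of_le_succ fun n => ?_
    induction n with
    | zero =>
      rw [hT0, Set.singleton_subset_iff]
      exact (hs 1).nil
    | succ n ih =>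
      rw [hT, hT]
      exact Set.image_mono (visible_mono ih)
  refine ⟨⋃ n, T n, Strat.iUnion hs hm, ?_⟩
  rw [unroll, visible_iUnion, Set.image_iUnion]
  apply Set.Subset.antisymm
  · refine Set.iUnion_subset fun n => ?_
    change unroll PM PN PB σ (T n) ⊆ _
    rw [← hT]
    exact Set.subset_iUnion T (n + 1)
  · refine Set.iUnion_subset fun n => (hm (Nat.le_succ n)).trans ?_
    rw [Nat.succ_eq_add_one, hT]
    exact Set.subset_iUnion (fun n => unroll PM PN PB σ (T n)) n

theorem shiftLeft_left (v : List ((Y ⊕ Y × ℕ) ⊕ X)) :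
    (v.map shiftLeft).filterMap Sum.getLeft? = (v.filterMap Sum.getLeft?).map shift := by
  rw [List.filterMap_map, List.map_filterMap]; congr 1; funext x; cases x <;> rfl

theorem shiftLeft_right (v : List ((Y ⊕ Y × ℕ) ⊕ X)) :
    (v.map shiftLeft).filterMap Sum.getRight? = v.filterMap Sum.getRight? := by
  rw [List.filterMap_map]; congr 1; funext x; cases x <;> rfl

/-- Induction on the number of moves in `!N`: the part of an interaction played by `τ` lacks the
moves of copy `0`, and there is at least one of these unless that part is empty. -/
theorem unroll_eq_subset {τ' : Set (List ((Y × ℕ) ⊕ X))}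
    (hσ : Strat (ImpPlays PM (SeqPlays PN PM)) σ) (hτ : Strat (ImpPlays PM PB) τ)
    (hτ' : Strat (ImpPlays PM PB) τ') (h : unroll PM PN PB σ τ = τ)
    (h' : unroll PM PN PB σ τ' = τ') : τ ⊆ τ' := by
  suffices ∀ n, ∀ v ∈ τ, (v.filterMap Sum.getLeft?).length = n → v ∈ τ' from
    fun v hv => this _ v hv rfl
  intro n
  induction n using Nat.strong_induction_on with
  | _ n ih =>
    intro v hv hn
    rw [← h] at hv
    obtain ⟨_, ⟨s, h1, h2, h3, rfl⟩, rfl⟩ := hv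
    rw [← h']
    refine ⟨_, ⟨s, h1, ?_, h3, rfl⟩, rfl⟩
    rw [shiftLeft_left, List.length_map, length_out_left] at hn
    have hc := confOk_of_mem (legal_of_mem hσ hτ h1 h2 h3).conf
    by_cases hz : s.filterMap zero? = []
    · obtain ⟨e1, e2⟩ := hc.init hz
      have := length_tail s
      rw [e1, e2] at this
      rw [List.length_eq_zero_iff.1 this]
      exact hτ'.nil
    · refine ih _ ?_ _ h2 rfl
      rw [tail_left]
      have := List.length_pos_iff.2 hz
      omega

theorem unroll_eq_unique {τ' : Set (List ((Y × ℕ) ⊕ X))}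
    (hσ : Strat (ImpPlays PM (SeqPlays PN PM)) σ) (hτ : Strat (ImpPlays PM PB) τ)
    (hτ' : Strat (ImpPlays PM PB) τ') (h : unroll PM PN PB σ τ = τ)
    (h' : unroll PM PN PB σ τ' = τ') : τ = τ' :=
  (unroll_eq_subset hσ hτ hτ' h h').antisymm (unroll_eq_subset hσ hτ' hτ h' h)

end

open Game

/-! ### Composition with a copycat strategy -/

section

variable {B C : Type*} (f : C → B) (PB : Set (List B)) (PC : Set (List C))

/-- The copycat traces relabelling along `f`, in terms of the sets of plays. -/
def CopycatPlays : Set (List (C ⊕ B)) :=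
  {s | s ∈ ImpPlays PB PC ∧ s.length % 2 = 0 ∧ ∀ t, t <+: s → t.length % 2 = 0 →
    (t.filterMap Sum.getLeft?).map f = t.filterMap Sum.getRight?}

variable {f PB PC}

theorem copycat_length {t : List (C ⊕ B)} (ht : t ∈ CopycatPlays f PB PC) :
    (t.filterMap Sum.getLeft?).length = (t.filterMap Sum.getRight?).length := by
  rw [← ht.2.2 t List.prefix_rfl ht.2.1, List.length_map]

/-- Copycat plays grow by pairs. At even length of the `C`-part the move `c` is Opponent's and its
copy follows it; at odd length Opponent has moved in `B` and `c` is the reply. -/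
theorem copycat_concat (hf : ∀ w : List C, w.map f ∈ PB ↔ w ∈ PC) {t : List (C ⊕ B)}
    (ht : t ∈ CopycatPlays f PB PC) {c : C} (hc : t.filterMap Sum.getLeft? ++ [c] ∈ PC) :
    ((t.filterMap Sum.getLeft?).length % 2 = 0 →
      t ++ [.inl c, .inr (f c)] ∈ CopycatPlays f PB PC) ∧
    ((t.filterMap Sum.getLeft?).length % 2 = 1 →
      t ++ [.inr (f c), .inl c] ∈ CopycatPlays f PB PC) := by
  have hl := copycat_length ht
  obtain ⟨h1, h2, h3⟩ := ht
  have e := h3 t List.prefix_rfl h2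
  have ho := impOk_of_mem h1
  have hb : t.filterMap Sum.getRight? ++ [f c] ∈ PB := by
    rw [← e]
    simpa using (hf _).2 hc
  constructor
  · intro hp
    rw [show t ++ [Sum.inl c, Sum.inr (f c)] = (t ++ [.inl c]) ++ [.inr (f c)] by simp]
    refine ⟨?_, ?_, ?_⟩
    · rw [concat_mem_impPlays, concat_mem_impPlays]
      refine ⟨⟨h1, ?_, ?_, ?_⟩, ?_, ?_, ?_⟩ <;> simp [List.filterMap_cons]
      exacts [hc, ho.right, by omega, hc, hb, by omega]
    · simp; omega
    · intro r hr hr2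
      rw [List.prefix_concat_iff, List.prefix_concat_iff] at hr
      rcases hr with rfl | rfl | hr
      · simpa [List.filterMap_cons] using e
      · simp at hr2; omega
      · exact h3 r hr hr2
  · intro hp
    rw [show t ++ [Sum.inr (f c), Sum.inl c] = (t ++ [.inr (f c)]) ++ [.inl c] by simp]
    refine ⟨?_, ?_, ?_⟩
    · rw [concat_mem_impPlays, concat_mem_impPlays]
      refine ⟨⟨h1, ?_, ?_, ?_⟩, ?_, ?_, ?_⟩ <;> simp [List.filterMap_cons]
      exacts [ho.left, hb, by omega, hc, hb, by omega]
    · simp; omega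
    · intro r hr hr2
      rw [List.prefix_concat_iff, List.prefix_concat_iff] at hr
      rcases hr with rfl | rfl | hr
      · simpa [List.filterMap_cons] using e
      · simp at hr2; omega
      · exact h3 r hr hr2

end

/-- If the letters copied by a copycat strategy occur in adjacent pairs, the restriction that
keeps the first letters of the pairs agrees with the one that keeps the second letters. -/
theorem filterMap_eq_of_pairs {L Y Z : Type*} {g₁ g₂ : L → Option Y} {h₁ h₂ : L → Option Z}
    {k : Y → Z}
    (H : ∀ x, (g₁ x = none ∧ g₂ x = none ∧ h₁ x = h₂ x) ∨
      (∃ y, g₁ x = some y ∧ g₂ x = none ∧ h₁ x = some (k y) ∧ h₂ x = none) ∨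
      (∃ y, g₁ x = none ∧ g₂ x = some y ∧ h₁ x = none ∧ h₂ x = some (k y)))
    {s : List L}
    (hev : ∀ t, t <+: s → ((t.filterMap g₁).length + (t.filterMap g₂).length) % 2 = 0 →
      t.filterMap g₁ = t.filterMap g₂)
    (hod : ∀ t x, t ++ [x] <+: s →
      ((t.filterMap g₁).length + (t.filterMap g₂).length) % 2 = 1 →
      ¬ (g₁ x = none ∧ g₂ x = none))
    (hs : ((s.filterMap g₁).length + (s.filterMap g₂).length) % 2 = 0) :
    s.filterMap h₁ = s.filterMap h₂ := by
  -- Within a pair the two restrictions differ. What survives there is that the pending letter is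
  -- the last one and that the restrictions agreed before it.
  suffices h : (((s.filterMap g₁).length + (s.filterMap g₂).length) % 2 = 0 →
      s.filterMap h₁ = s.filterMap h₂) ∧
      (((s.filterMap g₁).length + (s.filterMap g₂).length) % 2 = 1 →
      ∃ q x, s = q ++ [x] ∧ ((q.filterMap g₁).length + (q.filterMap g₂).length) % 2 = 0 ∧
        q.filterMap h₁ = q.filterMap h₂) from h.1 hs
  clear hs
  induction s using List.reverseRecOn with
  | nil => simp
  | append_singleton s x ih =>
    have hp : s <+: s ++ [x] := List.prefix_append _ _
    obtain ⟨ih1, ih2⟩ := ih (fun t ht => hev t (ht.trans hp)) fun t y ht =>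
      hod t y (ht.trans hp)
    rcases Nat.mod_two_eq_zero_or_one ((s.filterMap g₁).length + (s.filterMap g₂).length) with
      h0 | h0
    · rcases H x with ⟨e1, e2, e3⟩ | ⟨y, e1, e2, e3, e4⟩ | ⟨y, e1, e2, e3, e4⟩
      · simp only [List.filterMap_append, List.filterMap_cons, List.filterMap_nil, e1, e2, e3,
          List.append_nil]
        refine ⟨fun _ => by rw [ih1 h0], fun h => by omega⟩
      all_goals
        refine ⟨fun h => ?_, fun h => ⟨s, x, rfl, h0, ih1 h0⟩⟩
        simp only [List.filterMap_append, List.filterMap_cons, List.filterMap_nil, e1, e2,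
          List.append_nil, List.length_append, List.length_singleton] at h
        omega
    · have hx := hod s x List.prefix_rfl h0
      obtain ⟨q, z, rfl, hq, hq'⟩ := ih2 h0
      have hqe := hev q ((List.prefix_append _ _).trans hp) hq
      have hee := hev _ List.prefix_rfl
      have hx := (H x).resolve_left fun h => hx ⟨h.1, h.2.1⟩
      have hz := (H z).resolve_left fun h => by
        simp only [List.filterMap_append, List.filterMap_cons, List.filterMap_nil, h.1, h.2.1,
          List.append_nil] at h0
        omega
      rcases hx with ⟨y, e1, e2, e3, e4⟩ | ⟨y, e1, e2, e3, e4⟩ <;>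
      rcases hz with ⟨y', e1', e2', e3', e4'⟩ | ⟨y', e1', e2', e3', e4'⟩ <;>
      · simp only [List.filterMap_append, List.filterMap_cons, List.filterMap_nil, e1, e2, e3, e4,
          e1', e2', e3', e4', List.append_nil, List.length_append, List.length_singleton,
          List.append_assoc, List.nil_append] at hee ⊢
        refine ⟨fun h => ?_, fun h => by omega⟩
        have hee := hee (by omega)
        rw [hqe] at hee
        simp at hee
        try rw [hq', hee]

section

variable {A B C : Type u} {f : C → B} {PA : Set (List A)} {PB : Set (List B)} {PC : Set (List C)}

theorem projAB_left (s : List (A ⊕ B ⊕ C)) : (s.filterMap projAB).filterMap Sum.getLeft? =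
    (s.filterMap projBC).filterMap Sum.getRight? := by
  rw [List.filterMap_filterMap, List.filterMap_filterMap]; congr 1; funext x
  rcases x with a | b | c <;> rfl

theorem projAC_left (s : List (A ⊕ B ⊕ C)) : (s.filterMap projAC).filterMap Sum.getLeft? =
    (s.filterMap projBC).filterMap Sum.getLeft? := by
  rw [List.filterMap_filterMap, List.filterMap_filterMap]; congr 1; funext x
  rcases x with a | b | c <;> rfl

theorem projAC_right (s : List (A ⊕ B ⊕ C)) : (s.filterMap projAC).filterMap Sum.getRight? =
    (s.filterMap projAB).filterMap Sum.getRight? := by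
  rw [List.filterMap_filterMap, List.filterMap_filterMap]; congr 1; funext x
  rcases x with a | b | c <;> rfl

/-- Each `C`-move of `v` is expanded to a pair: the hidden copy goes after a move of Opponent and
before a move of Player, which the parity of the `C`-part distinguishes. -/
theorem exists_copycat_interaction (hf : ∀ w : List C, w.map f ∈ PB ↔ w ∈ PC)
    (hnil : [] ∈ ImpPlays PB PC) (v : List (C ⊕ A))
    (hv : v.map (Sum.map f id) ∈ ImpPlays PA PB) :
    ∃ s : List (A ⊕ B ⊕ C), s.filterMap projAB = v.map (Sum.map f id) ∧
      s.filterMap projBC ∈ CopycatPlays f PB PC ∧ s.filterMap projAC = v := by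
  induction v using List.reverseRecOn with
  | nil => exact ⟨[], rfl, ⟨hnil, rfl, by simp⟩, rfl⟩
  | append_singleton v x ih =>
    have hvB : ((v ++ [x]).filterMap Sum.getLeft?).map f ∈ PB := by
      convert (impOk_of_mem hv).left using 1
      rw [List.filterMap_map, List.map_filterMap]; congr 1; funext x; cases x <;> rfl
    rw [List.map_append] at hv
    obtain ⟨s, h1, h2, h3⟩ := ih (impPlays_of_prefix (List.prefix_append _ _) hv)
    rcases x with c | a
    · have e : v.filterMap Sum.getLeft? = (s.filterMap projBC).filterMap Sum.getLeft? := by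
        rw [← h3, projAC_left]
      have hc := (hf _).1 hvB
      simp only [List.filterMap_append, e] at hc
      obtain ⟨k1, k2⟩ := copycat_concat hf h2 hc
      rcases Nat.mod_two_eq_zero_or_one
        ((s.filterMap projBC).filterMap Sum.getLeft?).length with hp | hp
      · refine ⟨s ++ [.inr (.inr c), .inr (.inl (f c))], ?_, ?_, ?_⟩
        · simp [h1, projAB, List.filterMap_cons]
        · simpa [projBC, List.filterMap_cons] using k1 hp
        · simp [h3, projAC]
      · refine ⟨s ++ [.inr (.inl (f c)), .inr (.inr c)], ?_, ?_, ?_⟩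
        · simp [h1, projAB]
        · simpa [projBC, List.filterMap_cons] using k2 hp
        · simp [h3, projAC, List.filterMap_cons]
    · refine ⟨s ++ [.inl a], ?_, ?_, ?_⟩
      · simp [h1, projAB]
      · simpa [projBC, List.filterMap_cons] using h2
      · simp [h3, projAC]

theorem comp_copycat_eq (s : List (A ⊕ B ⊕ C))
    (h1 : s.filterMap projAB ∈ ImpPlays PA PB) (h2 : s.filterMap projBC ∈ CopycatPlays f PB PC) :
    (s.filterMap projAC).map (Sum.map f id) = s.filterMap projAB := by
  -- The two letters of a copied pair, both read in `B`.
  let g₁ : A ⊕ B ⊕ C → Option B := fun x => (projBC x).bind fun y => y.getLeft?.map f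
  let g₂ : A ⊕ B ⊕ C → Option B := fun x => (projBC x).bind Sum.getRight?
  have e1 : ∀ t : List (A ⊕ B ⊕ C), t.filterMap g₁ =
      ((t.filterMap projBC).filterMap Sum.getLeft?).map f := by
    intro t
    rw [List.map_filterMap, List.filterMap_filterMap]
  have e2 : ∀ t : List (A ⊕ B ⊕ C), t.filterMap g₂ =
      (t.filterMap projBC).filterMap Sum.getRight? := by
    intro t
    rw [List.filterMap_filterMap]
  have el : ∀ t : List (A ⊕ B ⊕ C), (t.filterMap g₁).length + (t.filterMap g₂).length =
      (t.filterMap projBC).length := by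
    intro t
    rw [e1, e2, List.length_map, length_filterMap_getLeft?_add]
  rw [List.map_filterMap]
  refine filterMap_eq_of_pairs (g₁ := g₁) (g₂ := g₂) (k := Sum.inl) ?_ ?_ ?_ ?_
  · rintro (a | b | c)
    · exact .inl ⟨rfl, rfl, rfl⟩
    · exact .inr (.inr ⟨b, rfl, rfl, rfl, rfl⟩)
    · exact .inr (.inl ⟨f c, rfl, rfl, rfl, rfl⟩)
  · intro t ht hl
    rw [el] at hl
    rw [e1, e2]
    exact h2.2.2 _ (ht.filterMap _) hl
  · rintro t x ht hl
    have a1 := (h1 _ (ht.filterMap projAB)).parity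
    have ht' : t <+: s := (List.prefix_append _ _).trans ht
    have a2 := (h1 _ (ht'.filterMap projAB)).parity
    have a3 := (h2.1 _ (ht'.filterMap projBC)).parity
    have a4 := length_filterMap_getLeft?_add (t.filterMap projBC)
    rw [el] at hl
    rw [projAB_left] at a2
    rcases x with a | b | c
    -- While the copycat owes a move the `B`-part is even, hence so is the `A`-part, and a move in
    -- `A` would make the latter odd.
    · exfalso
      rw [projAB_left] at a1
      simp only [List.filterMap_append, List.filterMap_cons, List.filterMap_nil, projAB, projBC,
        List.append_nil, List.length_append, List.length_singleton, Sum.getRight?_inr] at a1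
      omega
    · exact fun h => by simpa [g₂, projBC] using h.2
    · exact fun h => by simpa [g₁, projBC] using h.1
  · rw [el]
    exact h2.2.1

/-- Composition with a copycat strategy is relabelling. -/
theorem comp_copycat (hf : ∀ w : List C, w.map f ∈ PB ↔ w ∈ PC)
    (hnil : [] ∈ ImpPlays PB PC) {τ : Set (List (B ⊕ A))} (hτ : τ ⊆ ImpPlays PA PB)
    (v : List (C ⊕ A)) :
    (∃ s : List (A ⊕ B ⊕ C), s.filterMap projAB ∈ τ ∧
      s.filterMap projBC ∈ CopycatPlays f PB PC ∧ s.filterMap projAC = v) ↔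
    v.map (Sum.map f id) ∈ τ := by
  constructor
  · rintro ⟨s, h1, h2, rfl⟩
    rwa [comp_copycat_eq s (hτ h1) h2]
  · intro h
    obtain ⟨s, h1, h2, h3⟩ := exists_copycat_interaction hf hnil v (hτ h)
    exact ⟨s, h1 ▸ h, h2, h3⟩

end

/-! ### Composition with `id ⊘ τ` -/

section

open Letter

variable {X Y : Type u} {PM : Set (List X)} {PN : Set (List Y)} {PB : Set (List (Y × ℕ))}
variable {σ : Set (List ((Y ⊕ X) ⊕ X))} {τ : Set (List ((Y × ℕ) ⊕ X))}

variable (PM PN PB τ) in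
/-- The strategy `id ⊘ τ`, in terms of the sets of plays. -/
def SeqMapPlays : Set (List ((Y ⊕ Y × ℕ) ⊕ (Y ⊕ X))) :=
  {s | s ∈ ImpPlays (SeqPlays PN PM) (SeqPlays PN PB) ∧
    s.filterMap projFst ∈ CopycatPlays id PN PN ∧ s.filterMap projSnd ∈ τ}

/-- Forgetting the hidden copy of `N`. -/
def Letter.ofInteraction : X ⊕ (Y ⊕ X) ⊕ (Y ⊕ Y × ℕ) → Option (Letter X Y)
  | .inl x => some (ext x)
  | .inr (.inl (.inl _)) => none
  | .inr (.inl (.inr x)) => some (hid x)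
  | .inr (.inr (.inl y)) => some (zero y)
  | .inr (.inr (.inr p)) => some (succ p)

theorem ofInteraction_tail (s : List (X ⊕ (Y ⊕ X) ⊕ (Y ⊕ Y × ℕ))) :
    (s.filterMap ofInteraction).filterMap tail? = (s.filterMap projBC).filterMap projSnd := by
  rw [List.filterMap_filterMap, List.filterMap_filterMap]; congr 1; funext x
  rcases x with _ | (_ | _) | (_ | _) <;> rfl

theorem ofInteraction_out (s : List (X ⊕ (Y ⊕ X) ⊕ (Y ⊕ Y × ℕ))) :
    (s.filterMap ofInteraction).filterMap out? = s.filterMap projAC := by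
  rw [List.filterMap_filterMap]; congr 1; funext x
  rcases x with _ | (_ | _) | (_ | _) <;> rfl

theorem projFst_left (s : List ((Y ⊕ Y × ℕ) ⊕ (Y ⊕ X))) :
    (s.filterMap projFst).filterMap Sum.getLeft? =
      (s.filterMap Sum.getLeft?).filterMap Sum.getLeft? := by
  rw [List.filterMap_filterMap, List.filterMap_filterMap]; congr 1; funext x
  rcases x with (_ | _) | (_ | _) <;> rfl

theorem projFst_right (s : List ((Y ⊕ Y × ℕ) ⊕ (Y ⊕ X))) :
    (s.filterMap projFst).filterMap Sum.getRight? =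
      (s.filterMap Sum.getRight?).filterMap Sum.getLeft? := by
  rw [List.filterMap_filterMap, List.filterMap_filterMap]; congr 1; funext x
  rcases x with (_ | _) | (_ | _) <;> rfl

theorem projSnd_left (s : List ((Y ⊕ Y × ℕ) ⊕ (Y ⊕ X))) :
    (s.filterMap projSnd).filterMap Sum.getLeft? =
      (s.filterMap Sum.getLeft?).filterMap Sum.getRight? := by
  rw [List.filterMap_filterMap, List.filterMap_filterMap]; congr 1; funext x
  rcases x with (_ | _) | (_ | _) <;> rfl

theorem projSnd_right (s : List ((Y ⊕ Y × ℕ) ⊕ (Y ⊕ X))) :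
    (s.filterMap projSnd).filterMap Sum.getRight? =
      (s.filterMap Sum.getRight?).filterMap Sum.getRight? := by
  rw [List.filterMap_filterMap, List.filterMap_filterMap]; congr 1; funext x
  rcases x with (_ | _) | (_ | _) <;> rfl

/-- The parities of the restrictions of an interaction of `σ` and `id ⊘ τ`. -/
theorem interaction_parities {s : List (X ⊕ (Y ⊕ X) ⊕ (Y ⊕ Y × ℕ))}
    (h1 : s.filterMap projAB ∈ ImpPlays PM (SeqPlays PN PM))
    (h2 : s.filterMap projBC ∈ ImpPlays (SeqPlays PN PM) (SeqPlays PN PB))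
    (h3 : (s.filterMap projBC).filterMap projFst ∈ ImpPlays PN PN)
    (h4 : (s.filterMap projBC).filterMap projSnd ∈ ImpPlays PM PB) :
    let m := ((s.filterMap projAB).filterMap Sum.getRight?).length
    let n' := (((s.filterMap projBC).filterMap Sum.getRight?).filterMap Sum.getLeft?).length
    let m' := (((s.filterMap projBC).filterMap Sum.getRight?).filterMap Sum.getRight?).length
    let n := (((s.filterMap projBC).filterMap Sum.getLeft?).filterMap Sum.getLeft?).length
    let c := (((s.filterMap projBC).filterMap Sum.getLeft?).filterMap Sum.getRight?).length
    m % 2 ≤ (n' + m') % 2 ∧ (n' + m') % 2 ≤ (n + c) % 2 ∧ n' % 2 ≤ n % 2 ∧ m' % 2 ≤ c % 2 ∧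
      (n % 2 = 0 ∨ c % 2 = 0) := by
  have a1 := (impOk_of_mem h1).parity
  have a2 := (impOk_of_mem h2).parity
  have a3 := (impOk_of_mem h3).parity
  have a4 := (impOk_of_mem h4).parity
  have a5 := (seqOk_of_mem (impOk_of_mem h2).left).parity
  rw [projFst_left, projFst_right] at a3
  rw [projSnd_left, projSnd_right] at a4
  rw [projAB_left, ← length_filterMap_getLeft?_add
    ((s.filterMap projBC).filterMap Sum.getRight?)] at a1
  rw [← length_filterMap_getLeft?_add ((s.filterMap projBC).filterMap Sum.getRight?),
    ← length_filterMap_getLeft?_add ((s.filterMap projBC).filterMap Sum.getLeft?)] at a2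
  exact ⟨a1, a2, a3, a4, a5⟩

/-- No other letter can be played while the identity on `N` owes a move, so its letters come in
adjacent pairs and the hidden copy may be replaced by the visible one. -/
theorem ofInteraction_head {s : List (X ⊕ (Y ⊕ X) ⊕ (Y ⊕ Y × ℕ))}
    (h1 : s.filterMap projAB ∈ ImpPlays PM (SeqPlays PN PM))
    (h2 : s.filterMap projBC ∈ ImpPlays (SeqPlays PN PM) (SeqPlays PN PB))
    (h3 : (s.filterMap projBC).filterMap projFst ∈ CopycatPlays id PN PN)
    (h4 : (s.filterMap projBC).filterMap projSnd ∈ ImpPlays PM PB) :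
    (s.filterMap ofInteraction).filterMap head? = s.filterMap projAB := by
  let g₁ : X ⊕ (Y ⊕ X) ⊕ (Y ⊕ Y × ℕ) → Option Y := fun x =>
    (projBC x).bind fun y => (projFst y).bind Sum.getLeft?
  let g₂ : X ⊕ (Y ⊕ X) ⊕ (Y ⊕ Y × ℕ) → Option Y := fun x =>
    (projBC x).bind fun y => (projFst y).bind Sum.getRight?
  have e1 : ∀ t : List (X ⊕ (Y ⊕ X) ⊕ (Y ⊕ Y × ℕ)), t.filterMap g₁ =
      ((t.filterMap projBC).filterMap projFst).filterMap Sum.getLeft? := by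
    intro t
    rw [List.filterMap_filterMap, List.filterMap_filterMap]
  have e2 : ∀ t : List (X ⊕ (Y ⊕ X) ⊕ (Y ⊕ Y × ℕ)), t.filterMap g₂ =
      ((t.filterMap projBC).filterMap projFst).filterMap Sum.getRight? := by
    intro t
    rw [List.filterMap_filterMap, List.filterMap_filterMap]
  have el : ∀ t : List (X ⊕ (Y ⊕ X) ⊕ (Y ⊕ Y × ℕ)),
      (t.filterMap g₁).length + (t.filterMap g₂).length =
      ((t.filterMap projBC).filterMap projFst).length := by
    intro t
    rw [e1, e2, length_filterMap_getLeft?_add]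
  rw [List.filterMap_filterMap]
  refine filterMap_eq_of_pairs (g₁ := g₁) (g₂ := g₂) (k := fun y => .inl (.inl y)) ?_ ?_ ?_ ?_
  · rintro (a | (b | b) | (c | c))
    · exact .inl ⟨rfl, rfl, rfl⟩
    · exact .inr (.inr ⟨b, rfl, rfl, rfl, rfl⟩)
    · exact .inl ⟨rfl, rfl, rfl⟩
    · exact .inr (.inl ⟨c, rfl, rfl, rfl, rfl⟩)
    · exact .inl ⟨rfl, rfl, rfl⟩
  · intro t ht hl
    rw [el] at hl
    rw [e1, e2]
    simpa using h3.2.2 _ ((ht.filterMap _).filterMap _) hl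
  · rintro t x ht hl
    -- Within a pair the visible `N`-part is odd and all other parts are even. A move in the outer
    -- `M`, in the hidden `M` or in `!N` then violates `b1`, `b4` or `b5` respectively.
    have key : ∀ r, r <+: s → _ := fun r hr => interaction_parities
      (impPlays_of_prefix (hr.filterMap _) h1) (impPlays_of_prefix (hr.filterMap _) h2)
      (impPlays_of_prefix ((hr.filterMap _).filterMap _) h3.1)
      (impPlays_of_prefix ((hr.filterMap _).filterMap _) h4)
    obtain ⟨b1, b2, b3, b4, b5⟩ := key _ ht
    obtain ⟨a1, a2, a3, a4, a5⟩ := key t ((List.prefix_append _ _).trans ht)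
    rw [e1, e2, projFst_left, projFst_right] at hl
    rcases x with a | (b | b) | (c | c)
    · exfalso
      simp only [List.filterMap_append, List.filterMap_cons, List.filterMap_nil, projAB, projBC,
        List.append_nil, List.length_append, List.length_singleton, Sum.getRight?_inr] at b1
      clear b2 b3 b4 b5
      omega
    · exact fun h => by simpa [g₂, projBC, projFst] using h.2
    · exfalso
      simp only [List.filterMap_append, List.filterMap_cons, List.filterMap_nil, projBC,
        List.append_nil, List.length_append, List.length_singleton, Sum.getRight?_inr,
        Sum.getLeft?_inr] at b4
      clear b2 b3 b1 b5
      omega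
    · exact fun h => by simpa [g₁, projBC, projFst] using h.1
    · exfalso
      simp only [List.filterMap_append, List.filterMap_cons, List.filterMap_nil, projBC,
        List.append_nil, List.length_append, List.length_singleton, Sum.getRight?_inr,
        Sum.getLeft?_inl, Sum.getLeft?_inr] at b5
      clear b2 b3 b1 b4
      omega
  · rw [el]
    exact h3.2.1

theorem interaction_out_mem {s : List (X ⊕ (Y ⊕ X) ⊕ (Y ⊕ Y × ℕ))}
    (h1 : s.filterMap projAB ∈ ImpPlays PM (SeqPlays PN PM))
    (h2 : s.filterMap projBC ∈ ImpPlays (SeqPlays PN PM) (SeqPlays PN PB)) :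
    s.filterMap projAC ∈ ImpPlays PM (SeqPlays PN PB) := by
  rw [filterMap_mem_impPlays]
  intro t ht
  obtain ⟨-, a1, a2⟩ := h1 _ (ht.filterMap projAB)
  obtain ⟨b1, -, b2⟩ := h2 _ (ht.filterMap projBC)
  rw [projAB_left] at a2
  refine ⟨?_, ?_, ?_⟩ <;> simp only [projAC_left, projAC_right]
  exacts [b1, a1, a2.trans b2]

/-- Reinserts the hidden copy of `N`: each `zero y` becomes a pair, with the hidden letter second
for a move of Opponent in `N` and first for a move of Player. -/
theorem exists_interaction (hnil : [] ∈ PN) {r : List (Letter X Y)} (hr : r ∈ Conf PM PN PB) :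
    ∃ s : List (X ⊕ (Y ⊕ X) ⊕ (Y ⊕ Y × ℕ)), s.filterMap projAB = r.filterMap head? ∧
      s.filterMap projBC ∈ ImpPlays (SeqPlays PN PM) (SeqPlays PN PB) ∧
      (s.filterMap projBC).filterMap projFst ∈ CopycatPlays id PN PN ∧
      (s.filterMap projBC).filterMap projSnd = r.filterMap tail? ∧
      s.filterMap projAC = r.filterMap out? := by
  induction r using List.reverseRecOn with
  | nil =>
    obtain ⟨c1, c2, c3⟩ := mem_conf_iff.1 hr
    refine ⟨[], rfl, fun t ht => ?_, ⟨fun t ht => ?_, rfl, fun t ht _ => ?_⟩, rfl, rfl⟩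
    · rw [List.filterMap_nil, List.prefix_nil] at ht
      subst ht
      exact ⟨(impOk_of_mem c3).left, (impOk_of_mem c1).left, le_rfl⟩
    · rw [List.filterMap_nil, List.filterMap_nil, List.prefix_nil] at ht
      subst ht
      exact ⟨hnil, hnil, le_rfl⟩
    · rw [List.filterMap_nil, List.filterMap_nil, List.prefix_nil] at ht
      subst ht
      rfl
  | append_singleton r x ih =>
    obtain ⟨hc, hok⟩ := concat_mem_conf.1 hr
    obtain ⟨s, h1, h2, h3, h4, h5⟩ := ih hc
    obtain ⟨c1, c2, c3⟩ := mem_conf_iff.1 hr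
    have p0 := (confOk_of_mem hc).parities
    have p1 := hok.parities
    have eC : (s.filterMap projBC).filterMap Sum.getLeft? =
        (r.filterMap out?).filterMap Sum.getLeft? := by
      rw [← projAC_left, h5]
    have eB : (s.filterMap projBC).filterMap Sum.getRight? =
        (r.filterMap head?).filterMap Sum.getLeft? := by
      rw [← projAB_left, h1]
    have o2 := impOk_of_mem h2
    have oC := (impOk_of_mem c3).left
    have oB := (impOk_of_mem c1).left
    have lC := length_out_left r
    have lB := length_head_left r
    rw [← eC] at lC
    rw [← eB] at lB
    simp only [List.filterMap_append, ← eC, ← eB] at oC oB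
    simp only [List.filterMap_append, List.length_append] at p1
    rcases x with x | x | y | p
    · refine ⟨s ++ [.inl x], ?_, ?_, ?_, ?_, ?_⟩
      · simp [h1, projAB, head?]
      · simpa [projBC, List.filterMap_cons] using h2
      · simpa [projBC, List.filterMap_cons] using h3
      · simp [h4, projBC, tail?, List.filterMap_cons]
      · simp [h5, projAC, out?]
    · refine ⟨s ++ [.inr (.inl (.inr x))], ?_, ?_, ?_, ?_, ?_⟩
      · simp [h1, projAB, head?]
      · have e : (s ++ [Sum.inr (Sum.inl (Sum.inr x))]).filterMap projBC =
            s.filterMap projBC ++ [.inr (.inr x)] := filterMap_concat_some rfl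
        rw [e, concat_mem_impPlays]
        refine ⟨h2, ?_, ?_, ?_⟩
        · simpa [List.filterMap_cons] using o2.left
        · simpa [List.filterMap_cons, head?] using oB
        · simp only [List.filterMap_append, List.filterMap_cons, List.filterMap_nil, ext?, hid?,
            zero?, succ?, List.length_append, List.length_nil, List.length_singleton,
            Nat.add_zero, Sum.getRight?_inr, Sum.getLeft?_inr, List.append_nil, lB, lC] at p1 ⊢
          rcases p0 with h | h | h | h | h | h <;> rcases p1 with h' | h' | h' | h' | h' | h' <;>
            omega
      · simpa [projBC, projFst, List.filterMap_cons] using h3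
      · simp [h4, projBC, projSnd, tail?]
      · simp [h5, projAC, out?, List.filterMap_cons]
    · have hy : ((s.filterMap projBC).filterMap projFst).filterMap Sum.getLeft? ++ [y] ∈ PN := by
        rw [projFst_left, eC, out_left_left]
        simpa [zero?] using hok.zero
      have eZ : ((s.filterMap projBC).filterMap projFst).filterMap Sum.getLeft? =
          r.filterMap zero? := by
        rw [projFst_left, eC, out_left_left]
      obtain ⟨k1, k2⟩ := copycat_concat (f := id) (by simp) h3 hy
      rw [eZ] at k1 k2
      rcases Nat.mod_two_eq_zero_or_one (r.filterMap zero?).length with hp | hp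
      · refine ⟨s ++ [.inr (.inr (.inl y)), .inr (.inl (.inl y))], ?_, ?_, ?_, ?_, ?_⟩
        · simp [h1, projAB, head?, List.filterMap_cons]
        · have e : (s ++ [Sum.inr (Sum.inr (Sum.inl y)), Sum.inr (Sum.inl (Sum.inl y))]).filterMap projBC =
              (s.filterMap projBC ++ [.inl (.inl y)]) ++ [.inr (.inl y)] := by
            simp [projBC]
          rw [e, concat_mem_impPlays, concat_mem_impPlays]
          have oC' : (s.filterMap projBC).filterMap Sum.getLeft? ++ [.inl y] ∈ SeqPlays PN PB := by
            simpa [List.filterMap_cons, out?] using oC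
          have oB' : (s.filterMap projBC).filterMap Sum.getRight? ++ [.inl y] ∈
              SeqPlays PN PM := by
            simpa [List.filterMap_cons, head?] using oB
          have parity : (s.filterMap projBC |>.filterMap Sum.getRight?).length % 2 = 0 := by
            simp only [List.filterMap_cons, List.filterMap_nil, ext?, hid?,
              zero?, succ?, List.length_nil, List.length_singleton, Nat.add_zero] at p1
            rcases p0 with h | h | h | h | h | h <;>
              rcases p1 with h' | h' | h' | h' | h' | h' <;> omega
          have parity' : (s.filterMap projBC |>.filterMap Sum.getLeft?).length % 2 = 0 := by
            simp only [List.filterMap_cons, List.filterMap_nil, ext?, hid?,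
              zero?, succ?, List.length_nil, List.length_singleton, Nat.add_zero] at p1
            rcases p0 with h | h | h | h | h | h <;>
              rcases p1 with h' | h' | h' | h' | h' | h' <;> omega
          refine ⟨⟨h2, ?_, ?_, ?_⟩, ?_, ?_, ?_⟩ <;>
            simp only [List.filterMap_append, List.filterMap_cons, List.filterMap_nil,
              Sum.getRight?_inr, Sum.getLeft?_inr, Sum.getRight?_inl, Sum.getLeft?_inl,
              List.append_nil, List.length_append, List.length_singleton]
          exacts [oC', o2.right, by omega, oC', oB', by omega]
        · simpa [projBC, projFst, List.filterMap_cons] using k1 hp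
        · simp [h4, projBC, projSnd, tail?, List.filterMap_cons]
        · simp [h5, projAC, out?, List.filterMap_cons]
      · refine ⟨s ++ [.inr (.inl (.inl y)), .inr (.inr (.inl y))], ?_, ?_, ?_, ?_, ?_⟩
        · simp [h1, projAB, head?, List.filterMap_cons]
        · have e : (s ++ [Sum.inr (Sum.inl (Sum.inl y)), Sum.inr (Sum.inr (Sum.inl y))]).filterMap projBC =
              (s.filterMap projBC ++ [.inr (.inl y)]) ++ [.inl (.inl y)] := by
            simp [projBC]
          rw [e, concat_mem_impPlays, concat_mem_impPlays]
          have oC' : (s.filterMap projBC).filterMap Sum.getLeft? ++ [.inl y] ∈ SeqPlays PN PB := by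
            simpa [List.filterMap_cons, out?] using oC
          have oB' : (s.filterMap projBC).filterMap Sum.getRight? ++ [.inl y] ∈
              SeqPlays PN PM := by
            simpa [List.filterMap_cons, head?] using oB
          have parity : (s.filterMap projBC |>.filterMap Sum.getRight?).length % 2 = 1 := by
            simp only [List.filterMap_cons, List.filterMap_nil, ext?, hid?,
              zero?, succ?, List.length_nil, List.length_singleton, Nat.add_zero] at p1
            rcases p0 with h | h | h | h | h | h <;>
              rcases p1 with h' | h' | h' | h' | h' | h' <;> omega
          have parity' : (s.filterMap projBC |>.filterMap Sum.getLeft?).length % 2 = 1 := by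
            simp only [List.filterMap_cons, List.filterMap_nil, ext?, hid?,
              zero?, succ?, List.length_nil, List.length_singleton, Nat.add_zero] at p1
            rcases p0 with h | h | h | h | h | h <;>
              rcases p1 with h' | h' | h' | h' | h' | h' <;> omega
          refine ⟨⟨h2, ?_, ?_, ?_⟩, ?_, ?_, ?_⟩ <;>
            simp only [List.filterMap_append, List.filterMap_cons, List.filterMap_nil,
              Sum.getRight?_inr, Sum.getLeft?_inr, Sum.getRight?_inl, Sum.getLeft?_inl,
              List.append_nil, List.length_append, List.length_singleton]
          exacts [o2.left, oB', by omega, oC', oB', by omega]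
        · simpa [projBC, projFst, List.filterMap_cons] using k2 hp
        · simp [h4, projBC, projSnd, tail?, List.filterMap_cons]
        · simp [h5, projAC, out?, List.filterMap_cons]
    · refine ⟨s ++ [.inr (.inr (.inr p))], ?_, ?_, ?_, ?_, ?_⟩
      · simp [h1, projAB, head?, List.filterMap_cons]
      · have e : (s ++ [Sum.inr (Sum.inr (Sum.inr p))]).filterMap projBC =
            s.filterMap projBC ++ [.inl (.inr p)] := filterMap_concat_some rfl
        rw [e, concat_mem_impPlays]
        refine ⟨h2, ?_, ?_, ?_⟩
        · simpa [List.filterMap_cons, out?] using oC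
        · simpa [List.filterMap_cons] using o2.right
        · simp only [List.filterMap_append, List.filterMap_cons, List.filterMap_nil, ext?, hid?,
            zero?, succ?, List.length_append, List.length_nil, List.length_singleton,
            Nat.add_zero, Sum.getRight?_inl, Sum.getLeft?_inl, List.append_nil, lB, lC] at p1 ⊢
          rcases p0 with h | h | h | h | h | h <;> rcases p1 with h' | h' | h' | h' | h' | h' <;>
            omega
      · simpa [projBC, projFst, List.filterMap_cons] using h3
      · simp [h4, projBC, projSnd, tail?]
      · simp [h5, projAC, out?]

/-- The composite `(id ⊘ τ) ∘ σ` in terms of interactions in which the identity on `N` is elided. -/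
theorem comp_seqMap (hnil : [] ∈ PN) (hσ : σ ⊆ ImpPlays PM (SeqPlays PN PM))
    (hτ : τ ⊆ ImpPlays PM PB) (v : List ((Y ⊕ Y × ℕ) ⊕ X)) :
    (∃ s : List (X ⊕ (Y ⊕ X) ⊕ (Y ⊕ Y × ℕ)), s.filterMap projAB ∈ σ ∧
      s.filterMap projBC ∈ SeqMapPlays PM PN PB τ ∧ s.filterMap projAC = v) ↔
    v ∈ visible PM PN PB σ τ := by
  constructor
  · rintro ⟨s, h1, ⟨h2, h3, h4⟩, rfl⟩
    refine ⟨s.filterMap ofInteraction, ?_, ?_, ?_, ?_⟩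
    · rwa [ofInteraction_head (hσ h1) h2 h3 (hτ h4)]
    · rwa [ofInteraction_tail]
    · rw [ofInteraction_out]
      exact interaction_out_mem (hσ h1) h2
    · rw [ofInteraction_out]
  · rintro ⟨r, h1, h2, h3, rfl⟩
    obtain ⟨s, k1, k2, k3, k4, k5⟩ :=
      exists_interaction hnil (mem_conf_iff.2 ⟨hσ h1, hτ h2, h3⟩)
    exact ⟨s, k1 ▸ h1, ⟨k2, k3, k4 ▸ h2⟩, k5⟩

end

open Game

/-! ### Limits of increasing chains of finite sequences -/

section

variable {A B : Type*}

/-- `ℓ` is an increasing sequence for the prefix order. -/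
def PrefixChain (ℓ : ℕ → List A) : Prop := ∀ i j, i ≤ j → ℓ i <+: ℓ j

theorem prefixChain_of_succ {ℓ : ℕ → List A} (h : ∀ k, ℓ k <+: ℓ (k + 1)) : PrefixChain ℓ := by
  intro i j hij
  induction hij with
  | refl => exact List.prefix_rfl
  | step _ ih => exact ih.trans (h _)

theorem PrefixChain.filterMap {ℓ : ℕ → List A} (h : PrefixChain ℓ) (f : A → Option B) :
    PrefixChain fun k => (ℓ k).filterMap f :=
  fun i j hij => (h i j hij).filterMap f

theorem length_pre (s : ℕ → A) (n : ℕ) : (pre s n).length = n := by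
  simp [pre]

theorem pre_succ (s : ℕ → A) (n : ℕ) : pre s (n + 1) = pre s n ++ [s n] := by
  simp [pre, List.range_succ]

theorem prefixChain_pre (s : ℕ → A) : PrefixChain (pre s) :=
  prefixChain_of_succ fun k => by rw [pre_succ]; exact List.prefix_append _ _

theorem eq_pre_of_prefix {s : ℕ → A} {w : List A} {n : ℕ} (h : w <+: pre s n) :
    w = pre s w.length := by
  have hl := h.length_le
  rw [length_pre] at hl
  exact (List.prefix_of_prefix_length_le h (prefixChain_pre s _ _ hl)
    (by rw [length_pre])).eq_of_length (by rw [length_pre])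

/-- The sequence `t` is the limit of the chain `ℓ`. -/
def HasLim (ℓ : ℕ → List A) (t : ℕ → A) : Prop := ∀ w, (∃ k, w <+: ℓ k) ↔ ∃ n, w = pre t n

/-- The limit of the chain `ℓ` is an infinite sequence in `W` or a finite one in `F`. -/
def LimIn (W : Set (ℕ → A)) (F : Set (List A)) (ℓ : ℕ → List A) : Prop :=
  (∃ t ∈ W, HasLim ℓ t) ∨ ∃ v ∈ F, ∀ w, (∃ k, w <+: ℓ k) ↔ w <+: v

theorem HasLim.unique {ℓ : ℕ → List A} {t t' : ℕ → A} (h : HasLim ℓ t) (h' : HasLim ℓ t') :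
    t = t' := by
  funext n
  obtain ⟨m, hm⟩ := (h' _).1 ((h (pre t (n + 1))).2 ⟨_, rfl⟩)
  have := congrArg List.length hm
  rw [length_pre, length_pre] at this
  subst this
  rw [pre_succ, pre_succ] at hm
  have := List.append_inj_right' hm rfl
  simpa using this

theorem limIn_iff_of_hasLim {W : Set (ℕ → A)} {F : Set (List A)} {ℓ : ℕ → List A} {t : ℕ → A}
    (h : HasLim ℓ t) : LimIn W F ℓ ↔ t ∈ W := by
  constructor
  · rintro (⟨t', ht', h'⟩ | ⟨v, -, hv⟩)
    · rwa [h.unique h']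
    · have := ((hv _).1 ((h (pre t (v.length + 1))).2 ⟨_, rfl⟩)).length_le
      rw [length_pre] at this
      omega
  · exact fun ht => .inl ⟨t, ht, h⟩

theorem limIn_iff_of_eventually {W : Set (ℕ → A)} {F : Set (List A)} {ℓ : ℕ → List A} {K : ℕ}
    (hℓ : PrefixChain ℓ) (h : ∀ k, K ≤ k → ℓ k = ℓ K) : LimIn W F ℓ ↔ ℓ K ∈ F := by
  have hK : ∀ k, ℓ k <+: ℓ K := fun k => by
    have := hℓ k (max k K) (le_max_left _ _)
    rwa [h _ (le_max_right _ _)] at this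
  constructor
  · rintro (⟨t, -, ht⟩ | ⟨v, hvF, hv⟩)
    · obtain ⟨k, hk⟩ := (ht (pre t ((ℓ K).length + 1))).2 ⟨_, rfl⟩
      have := (hk.trans (hK k)).length_le
      rw [length_pre] at this
      omega
    · obtain ⟨k, hk⟩ := (hv v).2 List.prefix_rfl
      have h1 := (hv (ℓ K)).1 ⟨K, List.prefix_rfl⟩
      have h2 := hk.trans (hK k)
      rwa [h1.eq_of_length (le_antisymm h1.length_le h2.length_le)]
  · intro hF
    refine .inr ⟨_, hF, fun w => ⟨?_, fun hw => ⟨K, hw⟩⟩⟩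
    rintro ⟨k, hk⟩
    exact hk.trans (hK k)

/-- Cofinal chains have the same limit; this permits sampling a play only at stages of a suitable
parity. -/
theorem limIn_congr {W : Set (ℕ → A)} {F : Set (List A)} {ℓ ℓ' : ℕ → List A}
    (h : ∀ k, ∃ k', ℓ k <+: ℓ' k') (h' : ∀ k, ∃ k', ℓ' k <+: ℓ k') :
    LimIn W F ℓ ↔ LimIn W F ℓ' := by
  have : ∀ w, (∃ k, w <+: ℓ k) ↔ ∃ k, w <+: ℓ' k := by
    intro w
    constructor
    · rintro ⟨k, hk⟩
      exact (h k).imp fun _ => hk.trans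
    · rintro ⟨k, hk⟩
      exact (h' k).imp fun _ => hk.trans
  simp only [LimIn, HasLim, this]

/-- A chain converges to an infinite sequence or is eventually constant. -/
theorem PrefixChain.cases {ℓ : ℕ → List A} (hℓ : PrefixChain ℓ) :
    (∃ t, HasLim ℓ t) ∨ ∃ K, ∀ k, K ≤ k → ℓ k = ℓ K := by
  by_cases h : ∃ K, ∀ k, K ≤ k → (ℓ k).length = (ℓ K).length
  · obtain ⟨K, hK⟩ := h
    exact .inr ⟨K, fun k hk => ((hℓ K k hk).eq_of_length (hK k hk).symm).symm⟩
  · left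
    push Not at h
    have hlen : ∀ n, ∃ k, n < (ℓ k).length := by
      intro n
      induction n with
      | zero =>
        obtain ⟨k, hk, hne⟩ := h 0
        have := (hℓ 0 k hk).length_le
        exact ⟨k, by omega⟩
      | succ n ih =>
        obtain ⟨K, hK⟩ := ih
        obtain ⟨k, hk, hne⟩ := h K
        have := (hℓ K k hk).length_le
        exact ⟨k, by omega⟩
    choose κ hκ using hlen
    let t : ℕ → A := fun n => (ℓ (κ n))[n]'(hκ n)
    have key : ∀ k n (hn : n < (ℓ k).length), (ℓ k)[n] = t n := by
      intro k n hn
      rcases le_total k (κ n) with h | h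
      · exact (hℓ _ _ h).getElem hn
      · exact ((hℓ _ _ h).getElem (hκ n)).symm
    have hpre : ∀ k, ℓ k = pre t (ℓ k).length := by
      intro k
      apply List.ext_getElem
      · rw [length_pre]
      · intro i h1 h2
        rw [key k i h1]
        simp [pre]
    refine ⟨t, fun w => ⟨?_, ?_⟩⟩
    · rintro ⟨k, hk⟩
      rw [hpre k] at hk
      exact ⟨_, eq_pre_of_prefix hk⟩
    · rintro ⟨n, rfl⟩
      refine ⟨κ n, ?_⟩
      rw [hpre (κ n)]
      exact prefixChain_pre t _ _ (hκ n).le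

/-- A chain has precisely one limit, finite or infinite, so exactly one of two complementary winning
conditions holds. This is the content of negation. -/
theorem limIn_compl {P : Set (List A)} {W : Set (ℕ → A)} {F : Set (List A)} {ℓ : ℕ → List A}
    (hP : ∀ s t, s <+: t → t ∈ P → s ∈ P) (hℓ : PrefixChain ℓ) (h : ∀ k, ℓ k ∈ P) :
    LimIn ({s | ∀ n, pre s n ∈ P} \ W) (P \ F) ℓ ↔ ¬ LimIn W F ℓ := by
  rcases hℓ.cases with ⟨t, ht⟩ | ⟨K, hK⟩
  · rw [limIn_iff_of_hasLim ht, limIn_iff_of_hasLim ht, Set.mem_sdiff]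
    refine and_iff_right fun n => ?_
    obtain ⟨k, hk⟩ := (ht _).2 ⟨n, rfl⟩
    exact hP _ _ hk (h k)
  · rw [limIn_iff_of_eventually hℓ hK, limIn_iff_of_eventually hℓ hK, Set.mem_sdiff]
    exact and_iff_right (h K)

theorem HasLim.filterMap_congr {ℓ : ℕ → List A} {t : ℕ → A} (h : HasLim ℓ t)
    (f : A → Option B) {W : Set (ℕ → B)} {F : Set (List B)} :
    LimIn W F (fun k => (pre t k).filterMap f) ↔ LimIn W F fun k => (ℓ k).filterMap f := by
  refine limIn_congr (fun n => ?_) fun k => ?_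
  · exact ((h _).2 ⟨n, rfl⟩).imp fun _ hk => hk.filterMap f
  · obtain ⟨n, hn⟩ := (h (ℓ k)).1 ⟨k, List.prefix_rfl⟩
    exact ⟨n, by rw [← hn]⟩

end

theorem eq_of_concat_prefix {A : Type*} {r w : List A} {x y : A} (hx : r ++ [x] <+: w)
    (hy : r ++ [y] <+: w) : x = y := by
  have := (List.prefix_of_prefix_length_le hx hy (by simp)).eq_of_length (by simp)
  simpa using this

/-! ### Every copy is won; legal interactions can be extended -/

section

open Letter

variable {X Y : Type*} {PM : Set (List X)} {PN : Set (List Y)} {PB : Set (List (Y × ℕ))}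
variable {σ : Set (List ((Y ⊕ X) ⊕ X))} {τ : Set (List ((Y × ℕ) ⊕ X))}
variable {WM : Set (ℕ → X)} {FM : Set (List X)} {WN : Set (ℕ → Y)} {FN : Set (List Y)}

theorem exists_legal_of_mem (hσ : Strat (ImpPlays PM (SeqPlays PN PM)) σ)
    (hτ : Strat (ImpPlays PM PB) τ) (h : unroll PM PN PB σ τ = τ) {v : List ((Y × ℕ) ⊕ X)}
    (hv : v ∈ τ) : ∃ s : List (Letter X Y), Legal PM PN PB σ τ s ∧ s.filterMap head? ∈ σ ∧
      s.filterMap tail? ∈ τ ∧ (s.filterMap out?).map shiftLeft = v := by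
  rw [← h] at hv
  obtain ⟨_, ⟨s, h1, h2, h3, rfl⟩, e⟩ := hv
  exact ⟨s, legal_of_mem hσ hτ h1 h2 h3, h1, h2, e⟩

/-- Interactions depend monotonically on their visible parts. -/
theorem Legal.prefix_of_out_prefix (hσ : Strat (ImpPlays PM (SeqPlays PN PM)) σ)
    (hτ : Strat (ImpPlays PM PB) τ) {s s' : List (Letter X Y)} (h : Legal PM PN PB σ τ s)
    (h' : Legal PM PN PB σ τ s') (hs' : (s'.filterMap out?).length % 2 = 0)
    (hp : s.filterMap out? <+: s'.filterMap out?)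
    (hs : (s.filterMap out?).length % 2 = 0) : s <+: s' := by
  rcases h.prefix_or_prefix hσ hτ h' fun r x y _ hx hy =>
    eq_of_concat_prefix (hx.trans hp) hy with h1 | h1
  · exact h1
  · obtain ⟨r, rfl⟩ := h1
    rcases r with _ | ⟨z, r⟩
    · simp
    · have hz : s' ++ [z] <+: s' ++ z :: r := ⟨r, by simp⟩
      -- As `s'` is settled, a further letter would be visible and make the visible play of `s`
      -- longer than that of `s'`.
      obtain ⟨y, hy⟩ := (conf_mover (h.of_prefix hz).conf).2.2 hs'
      have := (hz.filterMap out?).trans hp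
      rw [filterMap_concat_some hy] at this
      have := this.length_le
      simp at this

theorem map_prefix_map_iff {A B : Type*} {f : A → B} (hf : Function.Injective f)
    {s t : List A} : s.map f <+: t.map f ↔ s <+: t := by
  constructor
  · intro h
    obtain ⟨r, hr, e⟩ := map_prefix_iff.1 h
    rwa [hf.list_map e] at hr
  · exact fun h => h.map f

/-- The limits of the plays in an anamorphism of a winning coalgebra are won in each copy. -/
theorem limIn_copy (hσ : Strat (ImpPlays PM (SeqPlays PN PM)) σ)
    (hτ : Strat (ImpPlays PM PB) τ) (h : unroll PM PN PB σ τ = τ)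
    (hW : ∀ ℓ : ℕ → List ((Y ⊕ X) ⊕ X), PrefixChain ℓ → (∀ k, ℓ k ∈ σ) →
      LimIn WM FM (fun k => (ℓ k).filterMap Sum.getRight?) →
      LimIn WN FN (fun k => ((ℓ k).filterMap Sum.getLeft?).filterMap Sum.getLeft?) ∧
      LimIn WM FM (fun k => ((ℓ k).filterMap Sum.getLeft?).filterMap Sum.getRight?)) (i : ℕ) :
    ∀ ℓ : ℕ → List ((Y × ℕ) ⊕ X), PrefixChain ℓ → (∀ k, ℓ k ∈ τ) →
      LimIn WM FM (fun k => (ℓ k).filterMap Sum.getRight?) →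
      LimIn WN FN (fun k => ((ℓ k).filterMap Sum.getLeft?).filterMap (copy i)) := by
  induction i with
  | zero =>
    intro ℓ hℓ hmem hM
    choose s hs h1 h2 h3 using fun k => exists_legal_of_mem hσ hτ h (hmem k)
    have hev : ∀ k, ((s k).filterMap out?).length % 2 = 0 := fun k => by
      have := hτ.even _ (hmem k)
      rwa [← h3 k, List.length_map] at this
    have hc : PrefixChain s := fun i j hij => by
      refine (hs i).prefix_of_out_prefix hσ hτ (hs j) (hev j) ?_ (hev i)
      rw [← map_prefix_map_iff shiftLeft_bijective.1, h3, h3]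
      exact hℓ i j hij
    have := hW _ (hc.filterMap head?) h1
    simp only [head_right, head_left_left, head_left_right] at this
    simp only [← h3, shiftLeft_right, out_right] at hM
    simp only [← h3, shiftLeft_left, copy_zero_comp_shift, out_left_left]
    exact (this hM).1
  | succ i ih =>
    intro ℓ hℓ hmem hM
    choose s hs h1 h2 h3 using fun k => exists_legal_of_mem hσ hτ h (hmem k)
    have hev : ∀ k, ((s k).filterMap out?).length % 2 = 0 := fun k => by
      have := hτ.even _ (hmem k)
      rwa [← h3 k, List.length_map] at this
    have hc : PrefixChain s := fun i j hij => by
      refine (hs i).prefix_of_out_prefix hσ hτ (hs j) (hev j) ?_ (hev i)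
      rw [← map_prefix_map_iff shiftLeft_bijective.1, h3, h3]
      exact hℓ i j hij
    have := hW _ (hc.filterMap head?) h1
    simp only [head_right, head_left_left, head_left_right] at this
    simp only [← h3, shiftLeft_right, out_right] at hM
    -- Copy `i + 1` is copy `i` of the play of `τ`, whose `M`-component is the hidden one; that
    -- component is won because `σ` is winning.
    have ih := ih _ (hc.filterMap tail?) h2
    simp only [tail_left, tail_right] at ih
    simp only [← h3, shiftLeft_left, copy_succ_comp_shift, out_left_right]
    exact ih (this hM).2

theorem filterMap_concat_none {A B : Type*} {f : A → Option B} {s : List A} {x : A}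
    (h : f x = none) : (s ++ [x]).filterMap f = s.filterMap f := by
  rw [List.filterMap_append, List.filterMap_cons_none h, List.filterMap_nil, List.append_nil]

theorem Legal.concat {s : List (Letter X Y)} {x : Letter X Y} (h : Legal PM PN PB σ τ s)
    (hx : ConfOk PM PN PB (s ++ [x]))
    (h1 : ((s ++ [x]).filterMap head?).length % 2 = 0 → (s ++ [x]).filterMap head? ∈ σ)
    (h2 : ((s ++ [x]).filterMap tail?).length % 2 = 0 → (s ++ [x]).filterMap tail? ∈ τ) :
    Legal PM PN PB σ τ (s ++ [x]) := by
  refine ⟨concat_mem_conf.2 ⟨h.conf, hx⟩, fun t ht => ?_, fun t ht => ?_⟩ <;>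
  rcases List.prefix_concat_iff.1 ht with rfl | ht
  exacts [h1, h.head t ht, h2, h.tail t ht]

/-- Opponent may make any visible move in a settled interaction. -/
theorem Legal.concat_out {s : List (Letter X Y)} {x : Letter X Y} {a : (Y ⊕ Y × ℕ) ⊕ X}
    (h : Legal PM PN PB σ τ s)
    (hs : (s.filterMap out?).length % 2 = 0) (hx : out? x = some a)
    (ha : s.filterMap out? ++ [a] ∈ ImpPlays PM (SeqPlays PN PB)) :
    Legal PM PN PB σ τ (s ++ [x]) := by
  obtain ⟨e1, e2⟩ := (conf_settled h.conf).1 hs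
  have p0 := (confOk_of_mem h.conf).parities
  have hok := confOk_of_mem h.conf
  rw [← filterMap_concat_some hx] at ha
  obtain ⟨a1, a2, a3⟩ := impOk_of_mem ha
  obtain ⟨b1, b2, b3, b4⟩ := seqOk_of_mem a1
  rw [length_out_left] at a3
  rw [length_out] at hs
  simp only [out_left_left, out_left_right, out_right] at a2 a3 b1 b2 b3 b4
  have hh : (s ++ [x]).filterMap hid? = s.filterMap hid? := by
    refine filterMap_concat_none ?_
    cases x <;> simp_all [out?, hid?]
  refine h.concat ?_ ?_ ?_
  · simp only [List.filterMap_append, List.length_append] at a3 b3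
    refine ⟨a2, hh ▸ hok.hid, b1, b2, ?_, ?_, ?_, ?_, ?_, fun e => ⟨?_, b4 e⟩⟩
    case refine_6 =>
      rw [hh]
      refine (hok.init ?_).1
      rw [List.filterMap_append] at e
      exact (List.append_eq_nil_iff.1 e).1
    all_goals
      rw [List.filterMap_append] at hh
      simp only [List.filterMap_append, List.length_append, hh]
      cases x <;>
      · simp only [List.filterMap_cons, List.filterMap_nil, ext?, zero?, succ?,
          List.length_nil, List.length_singleton, Nat.add_zero] at a3 b3 ⊢
        rcases p0 with p | p | p | p | p | p <;> omega
  · rcases hy : head? x with _ | y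
    · rw [filterMap_concat_none hy]
      exact h.head s List.prefix_rfl
    · rw [filterMap_concat_some hy, List.length_append, List.length_singleton]
      omega
  · rcases hy : tail? x with _ | y
    · rw [filterMap_concat_none hy]
      exact h.tail s List.prefix_rfl
    · rw [filterMap_concat_some hy, List.length_append, List.length_singleton]
      omega

theorem head?_surjective (b : (Y ⊕ X) ⊕ X) : ∃ x : Letter X Y, head? x = some b := by
  rcases b with (y | x) | x
  exacts [⟨zero y, rfl⟩, ⟨hid x, rfl⟩, ⟨ext x, rfl⟩]

theorem tail?_surjective (b : (Y × ℕ) ⊕ X) : ∃ x : Letter X Y, tail? x = some b := by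
  rcases b with p | x
  exacts [⟨succ p, rfl⟩, ⟨hid x, rfl⟩]

theorem out?_surjective (b : (Y ⊕ Y × ℕ) ⊕ X) : ∃ x : Letter X Y, out? x = some b := by
  rcases b with (y | p) | x
  exacts [⟨zero y, rfl⟩, ⟨succ p, rfl⟩, ⟨ext x, rfl⟩]

theorem exists_concat_of_odd {A : Type*} {s : List A} (h : s.length % 2 = 1) :
    ∃ t a, s = t ++ [a] := by
  rcases List.eq_nil_or_concat s with rfl | ⟨t, a, rfl⟩
  · simp at h
  · exact ⟨t, a, by simp⟩

/-- The strategy `σ` responds when it has to move. -/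
theorem Legal.exists_concat_head {s : List (Letter X Y)} (h : Legal PM PN PB σ τ s)
    (hσ : Strat (ImpPlays PM (SeqPlays PN PM)) σ)
    (hs : (s.filterMap head?).length % 2 = 1)
    (ht : ∀ t a, t ∈ σ → t ++ [a] ∈ ImpPlays PM (SeqPlays PN PM) → ∃ b, t ++ [a, b] ∈ σ) :
    ∃ x, Legal PM PN PB σ τ (s ++ [x]) := by
  obtain ⟨t, a, e⟩ := exists_concat_of_odd hs
  have htσ : t ∈ σ := by
    obtain ⟨r, hr, rfl⟩ := prefix_filterMap_iff.1 (e ▸ List.prefix_append t [a] :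
      t <+: s.filterMap head?)
    refine h.head r hr ?_
    rw [e, List.length_append, List.length_singleton] at hs
    omega
  obtain ⟨b, hb⟩ := ht t a htσ (e ▸ (mem_conf_iff.1 h.conf).1)
  obtain ⟨x, hx⟩ := head?_surjective b
  have hb : (s ++ [x]).filterMap head? ∈ σ := by
    rw [filterMap_concat_some hx, e]
    simpa using hb
  refine ⟨x, ?_⟩
  have p0 := (confOk_of_mem h.conf).parities
  have hok := confOk_of_mem h.conf
  obtain ⟨a1, a2, a3⟩ := impOk_of_mem (hσ.sub hb)
  obtain ⟨b1, b2, b3, b4⟩ := seqOk_of_mem a1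
  rw [length_head_left] at a3
  rw [length_head] at hs
  simp only [head_left_left, head_left_right, head_right] at a2 a3 b1 b2 b3 b4
  have hh : (s ++ [x]).filterMap succ? = s.filterMap succ? := by
    refine filterMap_concat_none ?_
    cases x <;> simp_all [head?, succ?]
  refine h.concat ?_ (fun _ => hb) ?_
  · simp only [List.filterMap_append, List.length_append] at a3 b3
    refine ⟨a2, b2, b1, hh ▸ hok.succ, ?_, ?_, ?_, ?_, ?_, fun e => ⟨b4 e, ?_⟩⟩
    case refine_6 =>
      rw [hh]
      refine (hok.init ?_).2
      rw [List.filterMap_append] at e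
      exact (List.append_eq_nil_iff.1 e).1
    all_goals
      rw [List.filterMap_append] at hh
      simp only [List.filterMap_append, List.length_append, hh]
      cases x <;>
      · simp only [List.filterMap_cons, List.filterMap_nil, ext?, zero?, hid?,
          List.length_nil, List.length_singleton, Nat.add_zero] at a3 b3 ⊢
        rcases p0 with p | p | p | p | p | p <;> omega
  -- `σ` and `τ` are never to move at once, so the new letter leaves the part of `τ` unchanged or
  -- makes it odd.
  · have hl : (s.filterMap tail?).length % 2 = 0 := by
      rw [length_tail]
      rcases p0 with p | p | p | p | p | p <;> omega
    rcases hy : tail? x with _ | y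
    · rw [filterMap_concat_none hy]
      exact h.tail s List.prefix_rfl
    · rw [filterMap_concat_some hy, List.length_append, List.length_singleton]
      omega

/-- The strategy `τ` responds when it has to move. -/
theorem Legal.exists_concat_tail {s : List (Letter X Y)} (h : Legal PM PN PB σ τ s)
    (hτ : Strat (ImpPlays PM PB) τ)
    (hs : (s.filterMap tail?).length % 2 = 1)
    (ht : ∀ t a, t ∈ τ → t ++ [a] = s.filterMap tail? → ∃ b, t ++ [a, b] ∈ τ) :
    ∃ x, Legal PM PN PB σ τ (s ++ [x]) := by
  obtain ⟨t, a, e⟩ := exists_concat_of_odd hs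
  have htτ : t ∈ τ := by
    obtain ⟨r, hr, rfl⟩ := prefix_filterMap_iff.1 (e ▸ List.prefix_append t [a] :
      t <+: s.filterMap tail?)
    refine h.tail r hr ?_
    rw [e, List.length_append, List.length_singleton] at hs
    omega
  obtain ⟨b, hb⟩ := ht t a htτ e.symm
  obtain ⟨x, hx⟩ := tail?_surjective b
  have hb : (s ++ [x]).filterMap tail? ∈ τ := by
    rw [filterMap_concat_some hx, e]
    simpa using hb
  refine ⟨x, ?_⟩
  have p0 := (confOk_of_mem h.conf).parities
  have hok := confOk_of_mem h.conf
  obtain ⟨a1, a2, a3⟩ := impOk_of_mem (hτ.sub hb)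
  rw [length_tail] at hs
  simp only [tail_left, tail_right] at a1 a2 a3
  have hh : (s ++ [x]).filterMap ext? = s.filterMap ext? := by
    refine filterMap_concat_none ?_
    cases x <;> simp_all [tail?, ext?]
  have hz : (s ++ [x]).filterMap zero? = s.filterMap zero? := by
    refine filterMap_concat_none ?_
    cases x <;> simp_all [tail?, zero?]
  refine h.concat ?_ ?_ (fun _ => hb)
  · simp only [List.filterMap_append, List.length_append] at a3
    refine ⟨hh ▸ hok.ext, a2, hz ▸ hok.zero, a1, ?_, ?_, ?_, ?_, ?_, fun e => ?_⟩
    case refine_6 =>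
      rw [hz] at e
      have := (hok.init e)
      rw [this.1, this.2] at hs
      simp at hs
    all_goals
      rw [List.filterMap_append] at hh hz
      simp only [List.filterMap_append, List.length_append, hh, hz]
      cases x <;>
      · simp only [List.filterMap_cons, List.filterMap_nil, succ?, hid?,
          List.length_nil, List.length_singleton, Nat.add_zero] at a3 ⊢
        rcases p0 with p | p | p | p | p | p <;> omega
  · have hl : (s.filterMap head?).length % 2 = 0 := by
      rw [length_head]
      rcases p0 with p | p | p | p | p | p <;> omega
    rcases hy : head? x with _ | y
    · rw [filterMap_concat_none hy]
      exact h.head s List.prefix_rfl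
    · rw [filterMap_concat_some hy, List.length_append, List.length_singleton]
      omega

end

open Game

/-! ### Totality: the hidden dialogue cannot go on for ever -/

section

open Letter

variable {X Y : Type*} {PM : Set (List X)} {PN : Set (List Y)} {PB : Set (List (Y × ℕ))}
variable {σ : Set (List ((Y ⊕ X) ⊕ X))} {τ : Set (List ((Y × ℕ) ⊕ X))}
variable {WM : Set (ℕ → X)} {FM : Set (List X)} {WN : Set (ℕ → Y)} {FN : Set (List Y)}

theorem exists_chain {A : Type*} {p : List A → Prop} {s : List A} (hs : p s)
    (h : ∀ r, p r → ∃ x, p (r ++ [x])) :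
    ∃ u : ℕ → List A, ∀ k, p (u k) ∧ ∃ x, u (k + 1) = u k ++ [x] := by
  choose f hf using h
  let u : ℕ → {r // p r} := fun k =>
    Nat.rec ⟨s, hs⟩ (fun _ r => ⟨r.1 ++ [f r.1 r.2], hf r.1 r.2⟩) k
  exact ⟨fun k => (u k).1, fun k => ⟨(u k).2, f (u k).1 (u k).2, rfl⟩⟩

/-- Infinite hidden interactions are excluded by the winning condition. -/
theorem not_chatter (hσ : Strat (ImpPlays PM (SeqPlays PN PM)) σ)
    (hτ : Strat (ImpPlays PM PB) τ) (h : unroll PM PN PB σ τ = τ)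
    (hW : ∀ ℓ : ℕ → List ((Y ⊕ X) ⊕ X), PrefixChain ℓ → (∀ k, ℓ k ∈ σ) →
      LimIn WM FM (fun k => (ℓ k).filterMap Sum.getRight?) →
      LimIn WN FN (fun k => ((ℓ k).filterMap Sum.getLeft?).filterMap Sum.getLeft?) ∧
      LimIn WM FM (fun k => ((ℓ k).filterMap Sum.getLeft?).filterMap Sum.getRight?))
    (hFM : ∀ w ∈ PM, w.length % 2 = 0 → w ∈ FM) (hFN : ∀ w ∈ FN, w.length % 2 = 0)
    (hPB : ∀ w ∈ PB, (∀ i, (w.filterMap (copy i)).length % 2 = 0) → w.length % 2 = 0)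
    {u : ℕ → List (Letter X Y)} (hu : ∀ k, Legal PM PN PB σ τ (u k))
    (hsucc : ∀ k, ∃ x, u (k + 1) = u k ++ [x] ∧ out? x = none)
    (hodd : ((u 0).filterMap out?).length % 2 = 1) : False := by
  have hstep : ∀ k, ∃ x, u (k + 1) = u k ++ [hid x] := by
    intro k
    obtain ⟨x, h1, h2⟩ := hsucc k
    cases x <;> simp_all [out?]
  have hc : PrefixChain u := prefixChain_of_succ fun k => by
    obtain ⟨x, hx⟩ := hstep k
    rw [hx]
    exact List.prefix_append _ _
  have hconst : ∀ k, (u k).filterMap ext? = (u 0).filterMap ext? ∧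
      (u k).filterMap zero? = (u 0).filterMap zero? ∧
      (u k).filterMap succ? = (u 0).filterMap succ? ∧
      ((u k).filterMap hid?).length = ((u 0).filterMap hid?).length + k := by
    intro k
    induction k with
    | zero => simp
    | succ k ih =>
      obtain ⟨x, hx⟩ := hstep k
      rw [hx, filterMap_concat_none (f := ext?) rfl, filterMap_concat_none (f := zero?) rfl,
        filterMap_concat_none (f := succ?) rfl, filterMap_concat_some (f := hid?) rfl,
        List.length_append, List.length_singleton]
      exact ⟨ih.1, ih.2.1, ih.2.2.1, by omega⟩
  have p0 := (confOk_of_mem (hu 0).conf).parities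
  rw [length_out] at hodd
  -- Every step is a hidden move of `M`, so parities alternate. The offset `e` makes the part of `σ`
  -- even at stages `2 * k + e`; since the visible play is odd, the part of `τ` is even one stage
  -- later.
  obtain ⟨e, he⟩ : ∃ e, ∀ k, ((u (2 * k + e)).filterMap head?).length % 2 = 0 ∧
      ((u (2 * k + e + 1)).filterMap tail?).length % 2 = 0 := by
    have key : ∀ j, ((u j).filterMap head?).length = ((u 0).filterMap zero?).length +
        (((u 0).filterMap hid?).length + j) + ((u 0).filterMap ext?).length := by
      intro j
      obtain ⟨c1, c2, c3, c4⟩ := hconst j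
      rw [length_head, c1, c2, c4]
    have key' : ∀ j, ((u j).filterMap tail?).length = ((u 0).filterMap succ?).length +
        (((u 0).filterMap hid?).length + j) := by
      intro j
      obtain ⟨c1, c2, c3, c4⟩ := hconst j
      rw [length_tail, c3, c4]
    simp only [key, key']
    refine ⟨((u 0).filterMap zero?).length + ((u 0).filterMap hid?).length +
      ((u 0).filterMap ext?).length, fun k => ⟨?_, ?_⟩⟩ <;> omega
  have hh := hW (fun k => (u (2 * k + e)).filterMap head?)
    (fun i j hij => (hc _ _ (by omega)).filterMap _)
    (fun k => (hu _).head _ List.prefix_rfl (he k).1)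
  simp only [head_right, head_left_left, head_left_right, (hconst _).1, (hconst _).2.1] at hh
  -- In each state where Opponent is not to move, the outer `M`-part is even, so it is a finite play
  -- won by Player.
  have hext : LimIn WM FM (fun _ : ℕ => (u 0).filterMap ext?) := by
    rw [limIn_iff_of_eventually (K := 0) (fun _ _ _ => List.prefix_rfl) fun _ _ => rfl]
    refine hFM _ (confOk_of_mem (hu 0).conf).ext ?_
    rcases p0 with p | p | p | p | p | p <;> omega
  obtain ⟨hz, hM⟩ := hh hext
  rw [limIn_iff_of_eventually (K := 0) (fun _ _ _ => List.prefix_rfl) fun _ _ => rfl] at hz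
  have hz := hFN _ hz
  have ht := fun i => limIn_copy hσ hτ h hW i (fun k => (u (2 * k + e + 1)).filterMap tail?)
    (fun i j hij => (hc _ _ (by omega)).filterMap _)
    (fun k => (hu _).tail _ List.prefix_rfl (he k).2)
  simp only [tail_right, tail_left, (hconst _).2.2.1] at ht
  have hM' : LimIn WM FM (fun k => (u (2 * k + e + 1)).filterMap hid?) := by
    refine (limIn_congr (fun k => ⟨k, ?_⟩) fun k => ⟨k + 1, ?_⟩).1 hM
    · exact (hc _ _ (by omega)).filterMap _
    · exact (hc _ _ (by omega)).filterMap _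
  -- The visible parts are constant, so a won copy has even length. Then all visible parts are even,
  -- against `hodd`.
  have hs : ((u 0).filterMap succ?).length % 2 = 0 := by
    refine hPB _ (confOk_of_mem (hu 0).conf).succ fun i => ?_
    have := ht i hM'
    rw [limIn_iff_of_eventually (K := 0) (fun _ _ _ => List.prefix_rfl) fun _ _ => rfl] at this
    exact hFN _ this
  rcases p0 with p | p | p | p | p | p <;> omega

/-- Anamorphisms of winning coalgebras are total. -/
theorem unroll_total (hσ : Strat (ImpPlays PM (SeqPlays PN PM)) σ)
    (hτ : Strat (ImpPlays PM PB) τ) (h : unroll PM PN PB σ τ = τ)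
    (hsh : ShiftPlays PM PN PB)
    (ht : ∀ t a, t ∈ σ → t ++ [a] ∈ ImpPlays PM (SeqPlays PN PM) → ∃ b, t ++ [a, b] ∈ σ)
    (hW : ∀ ℓ : ℕ → List ((Y ⊕ X) ⊕ X), PrefixChain ℓ → (∀ k, ℓ k ∈ σ) →
      LimIn WM FM (fun k => (ℓ k).filterMap Sum.getRight?) →
      LimIn WN FN (fun k => ((ℓ k).filterMap Sum.getLeft?).filterMap Sum.getLeft?) ∧
      LimIn WM FM (fun k => ((ℓ k).filterMap Sum.getLeft?).filterMap Sum.getRight?))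
    (hFM : ∀ w ∈ PM, w.length % 2 = 0 → w ∈ FM) (hFN : ∀ w ∈ FN, w.length % 2 = 0)
    (hPB : ∀ w ∈ PB, (∀ i, (w.filterMap (copy i)).length % 2 = 0) → w.length % 2 = 0) :
    ∀ v a, v ∈ τ → v ++ [a] ∈ ImpPlays PM PB → ∃ b, v ++ [a, b] ∈ τ := by
  suffices ∀ n v a, v ∈ τ → v ++ [a] ∈ ImpPlays PM PB →
      ((v ++ [a]).filterMap Sum.getLeft?).length = n → ∃ b, v ++ [a, b] ∈ τ from
    fun v a hv ha => this _ v a hv ha rfl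
  intro n
  induction n using Nat.strong_induction_on with
  | _ n ih =>
    intro v a hv ha hn
    by_contra hno
    push Not at hno
    obtain ⟨s, hs, h1, h2, rfl⟩ := exists_legal_of_mem hσ hτ h hv
    obtain ⟨a, rfl⟩ := shiftLeft_bijective.2 a
    obtain ⟨x, hx⟩ := out?_surjective a
    have hev : (s.filterMap out?).length % 2 = 0 := by
      have := hτ.even _ hv
      rwa [List.length_map] at this
    have eo : (s.filterMap out?).map shiftLeft ++ [shiftLeft a] =
        ((s ++ [x]).filterMap out?).map shiftLeft := by
      rw [filterMap_concat_some hx]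
      simp
    rw [eo] at ha hn
    have ha := (hsh _).1 ha
    have hl₀ := hs.concat_out hev hx (by rwa [filterMap_concat_some hx] at ha)
    have hodd : ((s ++ [x]).filterMap out?).length % 2 = 1 := by
      rw [filterMap_concat_some hx, List.length_append, List.length_singleton]
      omega
    rw [shiftLeft_left, List.length_map, length_out_left] at hn
    -- A move in copy `0` is present, so the part of `τ` has fewer moves in `!N` than the visible
    -- play. This is why the induction hypothesis supplies the responses of `τ`.
    have hzero : (s ++ [x]).filterMap zero? ≠ [] := by
      intro hz
      obtain ⟨e1, e2⟩ := (confOk_of_mem hl₀.conf).init hz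
      have p := (confOk_of_mem hl₀.conf).parities
      rw [length_out] at hodd
      simp only [hz, e1, e2, List.length_nil] at p hodd
      rcases p with p | p | p | p | p | p <;> omega
    have hzero := List.length_pos_iff.2 hzero
    -- Whichever of `σ` and `τ` is to move responds. A visible response would be an answer in
    -- `unroll σ τ = τ`, so without an answer the dialogue stays hidden for ever.
    obtain ⟨u, hu⟩ := exists_chain
      (p := fun r => Legal PM PN PB σ τ r ∧ r.filterMap out? = (s ++ [x]).filterMap out?)
      ⟨hl₀, rfl⟩ fun r ⟨hr, hro⟩ => by
        have hext : ∃ y, Legal PM PN PB σ τ (r ++ [y]) := by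
          have hro' : ¬ (r.filterMap out?).length % 2 = 0 := by rw [hro]; omega
          rw [conf_settled hr.conf] at hro'
          by_cases hp : (r.filterMap head?).length % 2 = 1
          · exact hr.exists_concat_head hσ hp ht
          · refine hr.exists_concat_tail hτ (by omega) fun t b ht hb => ?_
            refine ih _ ?_ t b ht (hb ▸ (mem_conf_iff.1 hr.conf).2.1) rfl
            rw [hb, tail_left, ← out_left_right, hro, out_left_right]
            omega
        obtain ⟨y, hy⟩ := hext
        rcases ho : out? y with _ | b
        · exact ⟨y, hy, by rw [filterMap_concat_none ho, hro]⟩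
        · exfalso
          have e : (r ++ [y]).filterMap out? = (s ++ [x]).filterMap out? ++ [b] := by
            rw [filterMap_concat_some ho, hro]
          have hev' : ((r ++ [y]).filterMap out?).length % 2 = 0 := by
            rw [e, List.length_append, List.length_singleton]
            omega
          obtain ⟨c1, c2⟩ := (conf_settled hy.conf).1 hev'
          refine hno (shiftLeft b) ?_
          rw [← h]
          refine ⟨_, ⟨r ++ [y], hy.head _ List.prefix_rfl c1, hy.tail _ List.prefix_rfl c2,
            (mem_conf_iff.1 hy.conf).2.2, rfl⟩, ?_⟩
          rw [e, filterMap_concat_some hx]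
          simp
    refine not_chatter hσ hτ h hW hFM hFN hPB (fun k => (hu k).1.1) (fun k => ?_)
      (by rw [(hu 0).1.2]; exact hodd)
    obtain ⟨y, hy⟩ := (hu k).2
    refine ⟨y, hy, ?_⟩
    have e1 := (hu k).1.2
    have e2 := (hu (k + 1)).1.2
    rcases ho : out? y with _ | b
    · rfl
    · rw [hy, filterMap_concat_some ho, e1] at e2
      simp at e2

end

/-! ### Strategies and winning conditions through parities and limits -/

namespace Game

variable {A M N : Game.{u}}

/-- In a negative game a nonempty play ends in a `P`-move iff its length is even, and removing pairs
of moves from any member of `σ` ends at the empty play. -/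
theorem isStrategy_iff (hA : A.IsNegative) {σ : Set (List A.Move)} :
    A.IsStrategy σ ↔ Strat A.plays σ := by
  constructor
  · intro h
    have even : ∀ s ∈ σ, s.length % 2 = 0 := by
      intro s hs
      rcases List.eq_nil_or_concat s with rfl | ⟨t, a, rfl⟩
      · rfl
      · rw [List.concat_eq_append] at hs ⊢
        have h1 := h.ends_in_P t a hs
        have h2 := lam_eq_O_iff hA (h.sub hs)
        rw [h1] at h2
        simp at h2
        rw [List.length_append, List.length_singleton]
        omega
    refine ⟨h.sub, even, ?_, h.closed, h.deterministic⟩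
    have hne : σ.Nonempty := by
      rw [Set.nonempty_iff_ne_empty]
      intro he
      have := h.of_empty he
      rw [hA] at this
      cases this
    obtain ⟨s, hs⟩ := hne
    exact mem_of_prefix_of_closed h.closed [] (s.length / 2) s (by have := even s hs; omega) hs
  · intro h
    refine ⟨h.sub, fun s a hs => ?_, h.closed, h.det, fun he => ?_, fun _ => hA⟩
    · rw [Player.eq_P_iff, lam_eq_O_iff hA (h.sub hs)]
      have := h.even _ hs
      rw [List.length_append, List.length_singleton] at this
      omega
    · exact absurd h.nil (by rw [he]; exact Set.notMem_empty _)

/-- The convention on the empty play makes the parity criterion hold without exception. -/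
theorem mem_finWin (hA : A.IsNegative) {s : List A.Move} :
    s ∈ A.finWin ↔ s ∈ A.plays ∧ s.length % 2 = 0 := by
  refine and_congr_right fun hs => ?_
  constructor
  · rintro (⟨t, a, rfl, ha⟩ | ⟨rfl, -⟩)
    · rw [Player.eq_P_iff, lam_eq_O_iff hA hs] at ha
      rw [List.length_append, List.length_singleton]
      omega
    · rfl
  · intro h
    rcases List.eq_nil_or_concat s with rfl | ⟨t, a, rfl⟩
    · exact .inr ⟨rfl, hA⟩
    · rw [List.concat_eq_append] at hs h ⊢
      refine .inl ⟨t, a, rfl, ?_⟩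
      rw [Player.eq_P_iff, lam_eq_O_iff hA hs]
      rw [List.length_append, List.length_singleton] at h
      omega

theorem neg_finWin : A.neg.finWin = A.plays \ A.finWin := by
  refine Set.ext fun s => and_congr_right fun hs => ?_
  constructor
  · rintro (⟨t, a, rfl, ha⟩ | ⟨rfl, h⟩) ⟨-, (⟨t', a', e, ha'⟩ | ⟨h', h''⟩)⟩
    · obtain ⟨-, rfl⟩ := List.append_singleton_inj.1 e
      change (A.lam a).swap = _ at ha
      rw [ha'] at ha
      cases ha
    · exact List.append_ne_nil_of_right_ne_nil t (List.cons_ne_nil a []) h'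
    · exact List.append_ne_nil_of_right_ne_nil t' (List.cons_ne_nil a' []) e.symm
    · change A.start.swap = _ at h
      rw [h''] at h
      cases h
  · intro h
    rcases List.eq_nil_or_concat s with rfl | ⟨t, a, rfl⟩
    · refine .inr ⟨rfl, ?_⟩
      change A.start.swap = _
      rcases hst : A.start with _ | _
      · exact absurd ⟨hs, .inr ⟨rfl, hst⟩⟩ h
      · rfl
    · rw [List.concat_eq_append] at hs h ⊢
      refine .inl ⟨t, a, rfl, ?_⟩
      change (A.lam a).swap = _
      rcases hst : A.lam a with _ | _
      · rfl
      · exact absurd ⟨hs, .inl ⟨t, a, rfl, hst⟩⟩ h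

theorem prefix_of_eq {X : Type*} {s t : List X} (h : s = t) : s <+: t := h ▸ List.prefix_rfl

/-- Replaces equations at particular stages by a condition on prefixes, which is insensitive to the
choice of a cofinal chain. -/
theorem restrictionWins_iff {X : Type u} {f : X → Option A.Move} {s : ℕ → X} :
    A.RestrictionWins f s ↔ LimIn A.win A.finWin fun k => (pre s k).filterMap f := by
  have hc : PrefixChain fun k => (pre s k).filterMap f := (prefixChain_pre s).filterMap f
  refine or_congr (exists_congr fun t => and_congr_right fun _ => ?_)
    (exists_congr fun v => and_congr_right fun _ => ?_)
  · constructor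
    · intro h w
      constructor
      · rintro ⟨k, hk : w <+: (pre s k).filterMap f⟩
        obtain ⟨k', hk'⟩ := h ((pre s k).filterMap f).length
        have : (pre s k).filterMap f = pre t ((pre s k).filterMap f).length := by
          rw [← hk']
          rcases le_total k k' with hkk | hkk
          · exact (hc _ _ hkk).eq_of_length (by dsimp only; rw [hk', length_pre])
          · exact ((hc _ _ hkk).eq_of_length (by dsimp only; rw [hk', length_pre])).symm
        exact ⟨_, eq_pre_of_prefix (this ▸ hk)⟩
      · rintro ⟨n, rfl⟩
        exact (h n).imp fun k (hk : (pre s k).filterMap f = _) => (prefix_of_eq hk.symm)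
    · intro h n
      obtain ⟨k, hk⟩ := (h (pre t n)).2 ⟨n, rfl⟩
      obtain ⟨r, hr, e⟩ := prefix_filterMap_iff.1 hk
      exact ⟨r.length, by rw [← e, ← eq_pre_of_prefix hr]⟩
  · constructor
    · rintro ⟨K, hK⟩ w
      constructor
      · rintro ⟨k, hk⟩
        have := hc k (max k K) (le_max_left _ _)
        dsimp only at this
        rw [hK _ (le_max_right _ _)] at this
        exact hk.trans this
      · exact fun hw => ⟨K, hw.trans (hK K le_rfl ▸ List.prefix_rfl)⟩
    · intro h
      obtain ⟨K, hK⟩ := (h v).2 List.prefix_rfl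
      refine ⟨K, fun m hm => ?_⟩
      have h1 := (h _).1 ⟨m, List.prefix_rfl⟩
      exact h1.eq_of_length (le_antisymm h1.length_le (hK.trans (hc _ _ hm)).length_le)

theorem neg_restrictionWins_iff {X : Type u} {f : X → Option A.Move} {s : ℕ → X}
    (h : ∀ k, (pre s k).filterMap f ∈ A.plays) :
    A.neg.RestrictionWins f s ↔ ¬ A.RestrictionWins f s := by
  have := limIn_compl (W := A.win) (F := A.finWin) A.prefix_closed
    ((prefixChain_pre s).filterMap f) h
  rw [← neg_finWin] at this
  exact (restrictionWins_iff (A := A.neg)).trans (this.trans (not_congr restrictionWins_iff.symm))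

/-- Each negation complements a winning condition because every restriction has exactly one limit;
what is left is a classical implication. -/
theorem mem_imp_win (hM : M.IsNegative) (hN : N.IsNegative) {s : ℕ → N.Move ⊕ M.Move} :
    s ∈ (imp M N).win ↔ (∀ n, pre s n ∈ (imp M N).plays) ∧
      (M.RestrictionWins Sum.getRight? s → N.RestrictionWins Sum.getLeft? s) := by
  refine and_congr_right fun h => ?_
  have hl : ∀ k, (pre s k).filterMap Sum.getLeft? ∈ N.plays := fun k =>
    (impOk_of_mem ((mem_imp_plays hM hN).1 (h k))).left
  have hr : ∀ k, (pre s k).filterMap Sum.getRight? ∈ M.plays := fun k =>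
    (impOk_of_mem ((mem_imp_plays hM hN).1 (h k))).right
  have e1 := neg_restrictionWins_iff hl
  have e2 := (neg_restrictionWins_iff (A := M.neg) hr).trans
    (not_congr (neg_restrictionWins_iff hr))
  rw [not_not] at e2
  change ¬ ((∀ n, pre s n ∈ (imp M N).plays) ∧ N.neg.RestrictionWins Sum.getLeft? s ∧
    M.neg.neg.RestrictionWins Sum.getRight? s) ↔ _
  refine (not_congr ((and_iff_right h).trans (and_congr e1 e2))).trans ?_
  tauto

theorem imp_plays_eq (hM : M.IsNegative) (hN : N.IsNegative) :
    (imp M N).plays = ImpPlays M.plays N.plays :=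
  Set.ext fun _ => mem_imp_plays hM hN

theorem sequoid_plays_eq (hA : A.IsNegative) (hN : N.IsNegative) :
    (A.sequoid N).plays = SeqPlays A.plays N.plays :=
  Set.ext fun _ => mem_sequoid_plays hA hN

theorem IsWinning.strat (hN : N.IsNegative) {σ : Traces M N}
    (h : (imp M N).IsWinning σ) : Strat (imp M N).plays σ :=
  (isStrategy_iff (imp_isNegative hN)).1 h.isTotal.isStrategy

theorem mem_of_consistent (hA : A.IsNegative) {σ : Set (List A.Move)} (hσ : Strat A.plays σ)
    {s : ℕ → A.Move} (hs : s ∈ A.infPlays) :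
    (∀ n, A.lam (s n) = .P → pre s (n + 1) ∈ σ) ↔ ∀ n, pre s (2 * n) ∈ σ := by
  have hlam : ∀ n, A.lam (s n) = .P ↔ n % 2 = 1 := by
    intro n
    have := hs (n + 1)
    rw [pre_succ] at this
    rw [Player.eq_P_iff, lam_eq_O_iff hA this, length_pre]
    omega
  constructor
  · rintro h (_ | n)
    · exact hσ.nil
    · exact h (2 * n + 1) ((hlam _).2 (by omega))
  · intro h n hn
    have hn := (hlam n).1 hn
    have := h ((n + 1) / 2)
    rwa [show 2 * ((n + 1) / 2) = n + 1 by omega] at this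

/-- The limits of the plays in a winning strategy are won. -/
theorem IsWinning.limIn (hM : M.IsNegative) (hN : N.IsNegative) {σ : Set (List (N.Move ⊕ M.Move))}
    (h : (imp M N).IsWinning σ) {ℓ : ℕ → List (N.Move ⊕ M.Move)} (hℓ : PrefixChain ℓ)
    (hmem : ∀ k, ℓ k ∈ σ)
    (hw : LimIn M.win M.finWin fun k => (ℓ k).filterMap Sum.getRight?) :
    LimIn N.win N.finWin fun k => (ℓ k).filterMap Sum.getLeft? := by
  have hσ : Strat (imp M N).plays σ := IsWinning.strat hN h
  rcases hℓ.cases with ⟨t, ht⟩ | ⟨K, hK⟩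
  · have hpre : ∀ n, ∃ k, pre t n <+: ℓ k := fun n => (ht _).2 ⟨n, rfl⟩
    have hinf : t ∈ (imp M N).infPlays := fun n => by
      obtain ⟨k, hk⟩ := hpre n
      exact (imp M N).prefix_closed _ _ hk (hσ.sub (hmem k))
    have hwin := h.wins t hinf ((mem_of_consistent (imp_isNegative hN) hσ hinf).2 fun n => by
      obtain ⟨k, hk⟩ := hpre (2 * n)
      refine hσ.of_prefix (hmem k) hk ?_
      exact (congrArg (· % 2) (length_pre t (2 * n))).trans (by omega))
    exact (ht.filterMap_congr _).1 (restrictionWins_iff.1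
      (((mem_imp_win hM hN).1 hwin).2 (restrictionWins_iff.2 ((ht.filterMap_congr _).2 hw))))
  -- A finite limit lies in `σ` and has even length; if its `M`-part is even, so is its `N`-part.
  · rw [limIn_iff_of_eventually (hℓ.filterMap _) fun k hk => by rw [hK k hk],
      mem_finWin hM] at hw
    rw [limIn_iff_of_eventually (hℓ.filterMap _) fun k hk => by rw [hK k hk], mem_finWin hN]
    have h1 : (ℓ K).length % 2 = 0 := hσ.even _ (hmem K)
    have h2 := length_filterMap_getLeft?_add (ℓ K)
    exact ⟨(impOk_of_mem ((mem_imp_plays hM hN).1 (hσ.sub (hmem K)))).left, by omega⟩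

/-- An infinite play consistent with `σ` is the limit of its even-length prefixes, which belong to
`σ`. -/
theorem isWinning_of_limIn (hM : M.IsNegative) (hN : N.IsNegative)
    {σ : Set (List (N.Move ⊕ M.Move))} (hσ : Strat (ImpPlays M.plays N.plays) σ)
    (ht : ∀ t a, t ∈ σ → t ++ [a] ∈ ImpPlays M.plays N.plays → ∃ b, t ++ [a, b] ∈ σ)
    (hw : ∀ ℓ : ℕ → List (N.Move ⊕ M.Move), PrefixChain ℓ → (∀ k, ℓ k ∈ σ) →
      LimIn M.win M.finWin (fun k => (ℓ k).filterMap Sum.getRight?) →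
      LimIn N.win N.finWin fun k => (ℓ k).filterMap Sum.getLeft?) :
    (imp M N).IsWinning σ := by
  rw [← imp_plays_eq hM hN] at hσ ht
  refine ⟨⟨(isStrategy_iff (imp_isNegative hN)).2 hσ, ⟨_, hσ.nil⟩, ht⟩, fun s hs h => ?_⟩
  have hmem := (mem_of_consistent (imp_isNegative hN) hσ hs).1 h
  refine (mem_imp_win hM hN).2 ⟨hs, fun hr => ?_⟩
  have hc : PrefixChain fun k => pre s (2 * k) := fun i j hij =>
    prefixChain_pre s _ _ (by omega)
  have key : ∀ {Z : Type u} (f : N.Move ⊕ M.Move → Option Z) {W : Set (ℕ → Z)} {F : Set (List Z)},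
      LimIn W F (fun k => (pre s k).filterMap f) ↔
      LimIn W F fun k => (pre s (2 * k)).filterMap f := fun f =>
    limIn_congr (fun k => ⟨k, (prefixChain_pre s _ _ (by omega)).filterMap f⟩)
      fun k => ⟨2 * k, List.prefix_rfl⟩
  exact restrictionWins_iff.2 ((key _).2 (hw _ hc hmem ((key _).1 (restrictionWins_iff.1 hr))))

/-- For a finite limit this rests on parity: at most one component is odd, so the total is even only
if both are. -/
theorem limIn_sequoid (hA : A.IsNegative) (hN : N.IsNegative) {ℓ : ℕ → List (A.Move ⊕ N.Move)}
    (hℓ : PrefixChain ℓ) (h : ∀ k, ℓ k ∈ SeqPlays A.plays N.plays) :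
    LimIn (A.sequoid N).win (A.sequoid N).finWin ℓ ↔
      LimIn A.win A.finWin (fun k => (ℓ k).filterMap Sum.getLeft?) ∧
      LimIn N.win N.finWin fun k => (ℓ k).filterMap Sum.getRight? := by
  rcases hℓ.cases with ⟨t, ht⟩ | ⟨K, hK⟩
  · refine (limIn_iff_of_hasLim (A := A.Move ⊕ N.Move) ht).trans ?_
    have hp : ∀ n, pre t n ∈ (A.sequoid N).plays := fun n => by
      obtain ⟨k, hk⟩ := (ht (pre t n)).2 ⟨n, rfl⟩
      exact (mem_sequoid_plays hA hN).2 (seqPlays_of_prefix hk (h k))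
    rw [← ht.filterMap_congr, ← ht.filterMap_congr, ← restrictionWins_iff, ← restrictionWins_iff]
    exact and_iff_right hp
  · refine ((limIn_iff_of_eventually (A := A.Move ⊕ N.Move) hℓ hK).trans
      (mem_finWin (sequoid_isNegative hA))).trans ?_
    rw [limIn_iff_of_eventually (hℓ.filterMap _) fun k hk => by rw [hK k hk],
      limIn_iff_of_eventually (hℓ.filterMap _) fun k hk => by rw [hK k hk],
      mem_finWin hA, mem_finWin hN]
    obtain ⟨h1, h2, h3, -⟩ := seqOk_of_mem (h K)
    have h4 := length_filterMap_getLeft?_add (ℓ K)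
    rw [and_iff_right h1, and_iff_right h2]
    refine (and_iff_right ((mem_sequoid_plays hA hN).2 (h K))).trans ?_
    change (ℓ K).length % 2 = 0 ↔ _
    omega

/-- A play of odd length ends in a move of Opponent, which leaves its own copy odd. -/
theorem bang_length_even_iff (hN : N.IsNegative) {s : List (N.Move × ℕ)}
    (hs : s ∈ N.bang.plays) :
    s.length % 2 = 0 ↔ ∀ i, (s.filterMap (copy i)).length % 2 = 0 := by
  obtain ⟨h1, h2, -⟩ := hs
  refine ⟨(bang_parity hN h1 h2).1, fun h => ?_⟩
  by_contra hodd
  obtain ⟨t, ⟨y, k⟩, rfl⟩ := exists_concat_of_odd (by omega : s.length % 2 = 1)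
  have ha := (alternating_concat.1 h1).2
  have hk := h2 k
  have e : (t ++ [(y, k)]).filterMap (copy k) = t.filterMap (copy k) ++ [y] :=
    filterMap_concat_some (by simp [copy])
  have hk' := h k
  rw [e] at hk hk'
  have := lam_eq_O_iff hN hk
  change N.lam y = .O ↔ _ at ha
  rw [this] at ha
  rw [List.length_append, List.length_singleton] at hk' hodd
  omega

theorem limIn_bang (hN : N.IsNegative) {ℓ : ℕ → List (N.Move × ℕ)}
    (hℓ : PrefixChain ℓ) (h : ∀ k, ℓ k ∈ N.bang.plays) :
    LimIn N.bang.win N.bang.finWin ℓ ↔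
      ∀ i, LimIn N.win N.finWin fun k => (ℓ k).filterMap (copy i) := by
  rcases hℓ.cases with ⟨t, ht⟩ | ⟨K, hK⟩
  · refine (limIn_iff_of_hasLim (A := N.Move × ℕ) ht).trans ?_
    have hp : ∀ n, pre t n ∈ N.bang.plays := fun n => by
      obtain ⟨k, hk⟩ := (ht (pre t n)).2 ⟨n, rfl⟩
      exact N.bang.prefix_closed _ _ hk (h k)
    simp only [← ht.filterMap_congr, ← restrictionWins_iff]
    exact and_iff_right hp
  · refine ((limIn_iff_of_eventually (A := N.Move × ℕ) hℓ hK).trans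
      ((mem_finWin bang_isNegative).trans (and_iff_right (h K)))).trans ?_
    refine (bang_length_even_iff hN (h K)).trans (forall_congr' fun i => ?_)
    rw [limIn_iff_of_eventually (hℓ.filterMap _) fun k hk => by rw [hK k hk], mem_finWin hN]
    exact (and_iff_right ((h K).2.1 i)).symm

end Game

open Game

/-! ### `α` is winning; homomorphisms are fixed points -/

section

variable {B C : Type*} {f : C → B} {PB : Set (List B)} {PC : Set (List C)}

theorem copycat_strat (hinj : Function.Injective f) (hnil : [] ∈ ImpPlays PB PC) :
    Strat (ImpPlays PB PC) (CopycatPlays f PB PC) where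
  sub _ h := h.1
  even _ h := h.2.1
  nil := ⟨hnil, rfl, by simp⟩
  closed := by
    rintro s a b ⟨h1, h2, h3⟩
    have hp : s <+: s ++ [a, b] := List.prefix_append _ _
    refine ⟨impPlays_of_prefix hp h1, ?_, fun t ht => h3 t (ht.trans hp)⟩
    simp at h2
    omega
  det := by
    intro s a b ha hb
    have la := copycat_length ha
    have lb := copycat_length hb
    have ea := ha.2.2 _ List.prefix_rfl ha.2.1
    have eb := hb.2.2 _ List.prefix_rfl hb.2.1
    rcases a with a | a <;> rcases b with b | b <;>
      simp [List.filterMap_cons] at la lb ea eb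
    · have := ea.trans eb.symm
      simp at this
      rw [hinj this]
    · omega
    · omega
    · have := ea.symm.trans eb
      simp at this
      rw [this]

theorem copycat_total (hf : ∀ w : List C, w.map f ∈ PB ↔ w ∈ PC) (hsurj : Function.Surjective f)
    (t : List (C ⊕ B)) (a : C ⊕ B) (ht : t ∈ CopycatPlays f PB PC)
    (ha : t ++ [a] ∈ ImpPlays PB PC) : ∃ b, t ++ [a, b] ∈ CopycatPlays f PB PC := by
  have hl := copycat_length ht
  have e := ht.2.2 t List.prefix_rfl ht.2.1
  obtain ⟨h1, h2, h3⟩ := impOk_of_mem ha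
  rcases a with c | b
  · simp [List.filterMap_cons] at h1 h3
    exact ⟨_, (copycat_concat hf ht h1).1 (by omega)⟩
  · obtain ⟨c, rfl⟩ := hsurj b
    simp [List.filterMap_cons] at h2 h3
    refine ⟨_, (copycat_concat hf ht ((hf _).1 ?_)).2 (by omega)⟩
    rw [List.map_append, e]
    exact h2

end

namespace Game

variable {M N : Game.{u}}

theorem alpha_eq (hN : N.IsNegative) :
    N.alpha = CopycatPlays shift N.bang.plays (SeqPlays N.plays N.bang.plays) := by
  have e := (imp_plays_eq bang_isNegative (sequoid_isNegative hN (B := N.bang))).trans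
    (congrArg (ImpPlays N.bang.plays) (sequoid_plays_eq hN bang_isNegative))
  refine Set.ext fun s => and_congr (Set.ext_iff.1 e s) (and_congr Nat.even_iff ?_)
  simp only [Nat.even_iff]
  exact Iff.rfl

theorem identity_eq (hN : N.IsNegative) : N.identity = CopycatPlays id N.plays N.plays := by
  refine Set.ext fun s => and_congr (mem_imp_plays hN hN) (and_congr Nat.even_iff ?_)
  simp only [Nat.even_iff]
  exact Iff.rfl

theorem sequoidFunctorMap_eq (hM : M.IsNegative) (hN : N.IsNegative) (τ : Traces M N.bang) :
    N.sequoidFunctorMap τ = SeqMapPlays M.plays N.plays N.bang.plays τ := by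
  have e := (imp_plays_eq (sequoid_isNegative hN (B := M))
    (sequoid_isNegative hN (B := N.bang))).trans
    (congrArg₂ ImpPlays (sequoid_plays_eq hN hM) (sequoid_plays_eq hN bang_isNegative))
  refine Set.ext fun s => and_congr (Set.ext_iff.1 e s) (and_congr ?_ Iff.rfl)
  exact Set.ext_iff.1 (identity_eq hN) _

theorem imp_sequoid_plays_eq (hM : M.IsNegative) (hN : N.IsNegative) :
    (imp M (N.sequoid M)).plays = ImpPlays M.plays (SeqPlays N.plays M.plays) :=
  (imp_plays_eq hM (sequoid_isNegative hN)).trans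
    (congrArg (ImpPlays M.plays) (sequoid_plays_eq hN hM))

theorem shiftPlays (hN : N.IsNegative) : ShiftPlays M.plays N.plays N.bang.plays := by
  intro s
  have key : ∀ t : List ((N.Move ⊕ N.Move × ℕ) ⊕ M.Move),
      ImpOk M.plays N.bang.plays (t.map shiftLeft) ↔
      ImpOk M.plays (SeqPlays N.plays N.bang.plays) t := by
    intro t
    constructor
    · rintro ⟨h1, h2, h3⟩
      refine ⟨(map_shift_mem_bang_plays hN).1 (shiftLeft_left t ▸ h1), shiftLeft_right t ▸ h2, ?_⟩
      have e := congrArg List.length (shiftLeft_left t)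
      have e' := congrArg List.length (shiftLeft_right t)
      rw [List.length_map] at e
      exact (congrArg (· % 2) e').ge.trans (h3.trans_eq (congrArg (· % 2) e))
    · rintro ⟨h1, h2, h3⟩
      have e := congrArg List.length (shiftLeft_left t)
      have e' := congrArg List.length (shiftLeft_right t)
      rw [List.length_map] at e
      refine ⟨?_, ?_, ?_⟩
      · exact (congrArg (· ∈ N.bang.plays) (shiftLeft_left t)).mpr
          ((map_shift_mem_bang_plays hN).2 h1)
      · exact (congrArg (· ∈ M.plays) (shiftLeft_right t)).mpr h2
      · exact (congrArg (· % 2) e').trans_le (h3.trans_eq (congrArg (· % 2) e.symm))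
  constructor
  · intro h t ht
    exact (key t).1 (h _ (ht.map _))
  · intro h w hw
    obtain ⟨t, ht, rfl⟩ := map_prefix_iff.1 hw
    exact (key t).2 (h t ht)

theorem nil_mem_impPlays {X Y : Type*} {P : Set (List X)} {Q : Set (List Y)} (hP : [] ∈ P)
    (hQ : [] ∈ Q) : [] ∈ ImpPlays P Q := by
  intro t ht
  rw [List.prefix_nil] at ht
  subst ht
  exact ⟨hQ, hP, le_rfl⟩

theorem nil_mem_seqPlays {X Y : Type*} {P : Set (List X)} {Q : Set (List Y)} (hP : [] ∈ P)
    (hQ : [] ∈ Q) : [] ∈ SeqPlays P Q := by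
  intro t ht
  rw [List.prefix_nil] at ht
  subst ht
  exact ⟨hP, hQ, .inl rfl, fun _ => rfl⟩

/-- Coalgebra homomorphisms into `!N` are the fixed points of `unroll`. -/
theorem isCoalgebraHom_iff (hM : M.IsNegative) (hN : N.IsNegative)
    {σ : Set (List ((N.Move ⊕ M.Move) ⊕ M.Move))}
    (hσ : σ ⊆ ImpPlays M.plays (SeqPlays N.plays M.plays))
    {τ : Set (List ((N.Move × ℕ) ⊕ M.Move))} (hτ : τ ⊆ ImpPlays M.plays N.bang.plays) :
    N.IsCoalgebraHom (M := M) (Z := N.bang) σ N.alpha τ ↔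
      unroll M.plays N.plays N.bang.plays σ τ = τ := by
  -- One side of the equation is a preimage under the relabelling, the other is `visible`. Since
  -- `shiftLeft` is bijective, the preimage can be traded for an image.
  have h1 : comp (A := M) (B := N.bang) (C := N.sequoid N.bang) N.alpha τ =
      List.map shiftLeft ⁻¹' τ := by
    rw [alpha_eq hN]
    refine Set.ext fun v => ?_
    exact comp_copycat (fun w => map_shift_mem_bang_plays hN)
      (nil_mem_impPlays (nil_mem_plays _) (nil_mem_seqPlays (nil_mem_plays _) (nil_mem_plays _)))
      hτ v
  have h2 : comp (A := M) (B := N.sequoid M) (C := N.sequoid N.bang) (N.sequoidFunctorMap τ) σ =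
      visible M.plays N.plays N.bang.plays σ τ := by
    have e : comp (A := M) (B := N.sequoid M) (C := N.sequoid N.bang) (N.sequoidFunctorMap τ) σ =
        comp (A := M) (B := N.sequoid M) (C := N.sequoid N.bang)
          (SeqMapPlays M.plays N.plays N.bang.plays τ) σ :=
      congrArg (fun ρ => comp (A := M) (B := N.sequoid M) (C := N.sequoid N.bang) ρ σ)
        (sequoidFunctorMap_eq hM hN τ)
    refine e.trans (Set.ext fun v => ?_)
    exact comp_seqMap (nil_mem_plays _) hσ hτ v
  have h3 : N.IsCoalgebraHom (M := M) (Z := N.bang) σ N.alpha τ ↔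
      List.map shiftLeft ⁻¹' τ = visible M.plays N.plays N.bang.plays σ τ := by
    rw [← h1, ← h2]
    exact Iff.rfl
  refine h3.trans ?_
  constructor
  · intro h
    change List.map shiftLeft '' visible M.plays N.plays N.bang.plays σ τ = τ
    rw [← h, Set.image_preimage_eq _ (List.map_surjective_iff.2 shiftLeft_bijective.2)]
  · intro h
    have h : List.map shiftLeft '' visible M.plays N.plays N.bang.plays σ τ = τ := h
    nth_rewrite 1 [← h]
    rw [Set.preimage_image_eq _ (List.map_injective_iff.2 shiftLeft_bijective.1)]

theorem alpha_isWinning (hN : N.IsNegative) :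
    (imp N.bang (N.sequoid N.bang)).IsWinning N.alpha := by
  have e := sequoid_plays_eq hN (bang_isNegative (N := N))
  have hnil : [] ∈ ImpPlays N.bang.plays (SeqPlays N.plays N.bang.plays) :=
    nil_mem_impPlays (nil_mem_plays _) (nil_mem_seqPlays (nil_mem_plays _) (nil_mem_plays _))
  have hstrat := copycat_strat (f := shift) shift_bijective.1 hnil
  have htotal := copycat_total (f := shift) (PB := N.bang.plays)
    (PC := SeqPlays N.plays N.bang.plays) (fun w => map_shift_mem_bang_plays hN) shift_bijective.2
  rw [alpha_eq hN]
  have e' : ImpPlays N.bang.plays (N.sequoid N.bang).plays =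
      ImpPlays N.bang.plays (SeqPlays N.plays N.bang.plays) := congrArg _ e
  refine isWinning_of_limIn bang_isNegative (sequoid_isNegative hN) ?_ ?_ ?_
  · rw [e']
    exact hstrat
  · rw [e']
    exact htotal
  · intro ℓ hℓ hmem h
    have hmem : ∀ k, ℓ k ∈ CopycatPlays (shift (X := N.Move)) N.bang.plays
      (SeqPlays N.plays N.bang.plays) := hmem
    -- Up to `shift` the two sides carry the same play: copy `0` of the source is the component `N`
    -- of the target, and copy `i + 1` is copy `i` of its component `!N`.
    have hr : ∀ k, (ℓ k).filterMap Sum.getRight? =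
        ((ℓ k).filterMap Sum.getLeft?).map shift := fun k =>
      ((hmem k).2.2 _ List.prefix_rfl (hmem k).2.1).symm
    have hplays : ∀ k, (ℓ k).filterMap Sum.getLeft? ∈ SeqPlays N.plays N.bang.plays := fun k =>
      (impOk_of_mem (hmem k).1).left
    have h := (limIn_bang hN (hℓ.filterMap Sum.getRight?) fun k =>
      (impOk_of_mem (hmem k).1).right).1 h
    refine (limIn_sequoid hN bang_isNegative (hℓ.filterMap Sum.getLeft?) hplays).2 ⟨?_, ?_⟩
    · have h := h 0
      simp only [hr] at h
      exact (congrArg _ (funext fun k => copy_zero_comp_shift _)).mp h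
    · refine (limIn_bang hN ((hℓ.filterMap Sum.getLeft?).filterMap Sum.getRight?) fun k =>
        (seqOk_of_mem (hplays k)).right).2 fun i => ?_
      have h := h (i + 1)
      simp only [hr] at h
      exact (congrArg _ (funext fun k => copy_succ_comp_shift i _)).mp h

/-- Totality is `unroll_total`. A play of `!N` is won iff each copy is, so the winning condition is
`limIn_copy`. -/
theorem isWinning_of_isCoalgebraHom (hM : M.IsNegative) (hN : N.IsNegative)
    {σ : Set (List ((N.Move ⊕ M.Move) ⊕ M.Move))} (hσ : (imp M (N.sequoid M)).IsWinning σ)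
    {τ : Set (List ((N.Move × ℕ) ⊕ M.Move))} (hτ : Strat (ImpPlays M.plays N.bang.plays) τ)
    (h : unroll M.plays N.plays N.bang.plays σ τ = τ) : (imp M N.bang).IsWinning τ := by
  have hs : Strat (ImpPlays M.plays (SeqPlays N.plays M.plays)) σ := by
    have := IsWinning.strat (sequoid_isNegative hN) hσ
    rw [imp_sequoid_plays_eq hM hN] at this
    exact this
  have ht : ∀ t a, t ∈ σ → t ++ [a] ∈ ImpPlays M.plays (SeqPlays N.plays M.plays) →
      ∃ b, t ++ [a, b] ∈ σ := by
    have := hσ.isTotal.responds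
    rw [imp_sequoid_plays_eq hM hN] at this
    exact this
  have hW : ∀ ℓ : ℕ → List ((N.Move ⊕ M.Move) ⊕ M.Move), PrefixChain ℓ → (∀ k, ℓ k ∈ σ) →
      LimIn M.win M.finWin (fun k => (ℓ k).filterMap Sum.getRight?) →
      LimIn N.win N.finWin (fun k => ((ℓ k).filterMap Sum.getLeft?).filterMap Sum.getLeft?) ∧
      LimIn M.win M.finWin (fun k => ((ℓ k).filterMap Sum.getLeft?).filterMap Sum.getRight?) := by
    intro ℓ hℓ hmem hw
    exact (limIn_sequoid hN hM (hℓ.filterMap Sum.getLeft?) fun k =>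
      (impOk_of_mem (hs.sub (hmem k))).left).1
      (IsWinning.limIn hM (sequoid_isNegative hN) hσ hℓ hmem hw)
  refine isWinning_of_limIn hM bang_isNegative hτ ?_ fun ℓ hℓ hmem hw => ?_
  · exact unroll_total hs hτ h (shiftPlays hN) ht hW (fun w h1 h2 => (mem_finWin hM).2 ⟨h1, h2⟩)
      (fun w hw => ((mem_finWin hN).1 hw).2) fun w hw => (bang_length_even_iff hN hw).2
  · exact (limIn_bang hN (hℓ.filterMap Sum.getLeft?) fun k =>
      (impOk_of_mem (hτ.sub (hmem k))).left).2 fun i =>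
        limIn_copy hs hτ h hW i ℓ hℓ hmem hw

end Game

end PlayGame

theorem mainTheorem5 (N : PlayGame.Game.{u}) (hN : N.IsNegative) :
    N.IsFinalCoalgebra N.bang N.alpha ∧
    ∀ (M : PlayGame.Game.{u}), M.IsNegative →
      ∀ σ : PlayGame.Game.Traces M (N.sequoid M),
        (PlayGame.Game.imp M (N.sequoid M)).IsWinning σ →
        ∀ τ : PlayGame.Game.Traces M N.bang,
          (PlayGame.Game.imp M N.bang).IsStrategy τ →
          N.IsCoalgebraHom σ N.alpha τ →
          (PlayGame.Game.imp M N.bang).IsWinning τ := by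
  open PlayGame PlayGame.Game in
  have strat : ∀ {M : PlayGame.Game.{u}}, M.IsNegative → ∀ {τ : Traces M N.bang},
      (imp M N.bang).IsStrategy τ → Strat (ImpPlays M.plays N.bang.plays) τ := by
    intro M hM τ hτ
    have := (isStrategy_iff (imp_isNegative bang_isNegative)).1 hτ
    rw [imp_plays_eq hM bang_isNegative] at this
    exact this
  open PlayGame PlayGame.Game in
  have stratHead : ∀ {M : PlayGame.Game.{u}}, M.IsNegative → ∀ {σ : Traces M (N.sequoid M)},
      (imp M (N.sequoid M)).IsWinning σ →
      Strat (ImpPlays M.plays (SeqPlays N.plays M.plays)) σ := by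
    intro M hM σ hσ
    have := IsWinning.strat (sequoid_isNegative hN) hσ
    rw [imp_sequoid_plays_eq hM hN] at this
    exact this
  open PlayGame PlayGame.Game in
  refine ⟨⟨bang_isNegative, alpha_isWinning hN, fun M hM σ hσ => ?_⟩,
    fun M hM σ hσ τ hτ h => ?_⟩
  · have hs := stratHead hM hσ
    obtain ⟨τ, hτ, h⟩ := PlayGame.exists_unroll_eq hs (PlayGame.Game.shiftPlays hN)
      (PlayGame.Game.nil_mem_impPlays (PlayGame.Game.nil_mem_plays _)
        (PlayGame.Game.nil_mem_plays _))
    refine ⟨τ, ⟨PlayGame.Game.isWinning_of_isCoalgebraHom hM hN hσ hτ h,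
      (PlayGame.Game.isCoalgebraHom_iff hM hN hs.sub hτ.sub).2 h⟩, ?_⟩
    rintro τ' ⟨hw, h'⟩
    have hτ' := strat hM hw.isTotal.isStrategy
    -- Uniqueness needs only that both fixed points are strategies.
    exact PlayGame.unroll_eq_unique hs hτ' hτ
      ((PlayGame.Game.isCoalgebraHom_iff hM hN hs.sub hτ'.sub).1 h') h
  · have hs := stratHead hM hσ
    have hτ := strat hM hτ
    exact PlayGame.Game.isWinning_of_isCoalgebraHom hM hN hσ hτ
      ((PlayGame.Game.isCoalgebraHom_iff hM hN hs.sub hτ.sub).1 h)
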